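/- Let $\mathbf X=\{(X_1(t),X_2(t))^\top,\ t\in\mathbb R\}$ be a stationary bivariate Gaussian process with mean zero and covariance functions $C_{ij}(t)=\mathrm E[X_i(s)X_j(s+t)]$, $i,j\in\{1,2\}$. Let $\alpha_{11},\alpha_{22}\in(0,2)$, $\sigma_1,\sigma_2>0$, $0<|\rho|<1$, $c_{11},c_{22},c_{12}>0$, $\beta_{11},\beta_{22},\beta_{12}>0$ and $\alpha_{12}$ be constants such that either $\frac{\alpha_{11}+\alpha_{22}}2<\alpha_{12}$, or $\frac{\alpha_{11}+\alpha_{22}}2=\alpha_{12}$ and $c_{12}^2\rho^2\sigma_1^2\sigma_2^2<c_{11}c_{22}$. Assume (A3): as $t\to0$, $$C_{ii}(t)=\sigma_i^2-c_{ii}|t|^{\alpha_{ii}}+O(|t|^{\alpha_{ii}+\beta_{ii}})\ (i=1,2),\qquad C_{12}(t)=C_{21}(t)=\rho\sigma_1\sigma_2\big(1-c_{12}|t|^{\alpha_{12}}+O(|t|^{\alpha_{12}+\beta_{12}})\big).$$ Assume (A2): all $C_{ij}$ are four times differentiable on $\mathbb R\setminus\{0\}$ and, writing $(a)_4=a(a-1)(a-2)(a-3)$,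 as $t\to0$, $t\neq0$, $$C_{ii}^{(4)}(t)=-c_{ii}(\alpha_{ii})_4|t|^{\alpha_{ii}-4}+o(|t|^{\alpha_{ii}-4})\ (i=1,2),\qquad C_{12}^{(4)}(t)=C_{21}^{(4)}(t)=-\rho\sigma_1\sigma_2c_{12}(\alpha_{12})_4|t|^{\alpha_{12}-4}+o(|t|^{\alpha_{12}-4}).$$ Fix an integer $m\ge2$ and real weights $L_{u,i}$ ($1\le u\le m$, $i=1,2$) with $\sum_{u=1}^mL_{u,i}=0$ and $\sum_{u=1}^mL_{u,i}\ln u=1$. For $n\ge1$ put $$Y^u_{n,i}(j)=n^{\alpha_{ii}/2}\Big(X_i\big(\tfrac{j-u}n\big)-2X_i\big(\tfrac jn\big)+X_i\big(\tfrac{j+u}n\big)\Big),\quad \bar Z^u_{n,i}=\frac1n\sum_{j=1}^n\big(Y^u_{n,i}(j)\big)^2,\quad \hat\alpha_{ii}=\sum_{u=1}^mL_{u,i}\ln\bar Z^u_{n,i},$$ and let $\boldsymbol\alpha=(\alpha_{11},\alpha_{22})^\top$, $\hat{\boldsymbol\alpha}=(\hat\alpha_{11},\hat\alpha_{22})^\top$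 and $\psi(x_1,x_2)=\min\{1+x_1,\,1+x_2,\,x_1+x_2\}$. Then for all sufficiently large $n$ every $\bar Z^u_{n,i}$ is almost surely positive and the entries of $(\hat{\boldsymbol\alpha}-\boldsymbol\alpha)(\hat{\boldsymbol\alpha}-\boldsymbol\alpha)^\top$ are integrable, and the following holds as $n\to\infty$. If $(\alpha_{11}+\alpha_{22})/2=\alpha_{12}$, then $$\mathrm E[(\hat{\boldsymbol\alpha}-\boldsymbol\alpha)(\hat{\boldsymbol\alpha}-\boldsymbol\alpha)^\top]=\begin{pmatrix}O(n^{-1})&O(n^{-1})\\O(n^{-1})&O(n^{-1})\end{pmatrix}+\begin{pmatrix}O(n^{-\psi(\beta_{11},\beta_{11})})&O(n^{-\psi(\beta_{11},\beta_{22})})\\O(n^{-\psi(\beta_{11},\beta_{22})})&O(n^{-\psi(\beta_{22},\beta_{22})})\end{pmatrix}.$$ If $(\alpha_{11}+\alpha_{22})/2<\alpha_{12}$, then $$\mathrm E[(\hat{\boldsymbol\alpha}-\boldsymbol\alpha)(\hat{\boldsymbol\alpha}-\boldsymbol\alpha)^\top]=\begin{pmatrix}O(n^{-1})&o(n^{-1})\\o(n^{-1})&O(n^{-1})\end{pmatrix}+\begin{pmatrix}O(n^{-\psi(\beta_{11},\beta_{11})})&O(n^{-\psi(\beta_{11},\beta_{22})})\\O(n^{-\psi(\beta_{11},\beta_{22})})&O(n^{-\psi(\beta_{22},\beta_{22})})\end{pmatrix}.$$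 -/

import Mathlib

open MeasureTheory ProbabilityTheory Filter Asymptotics
open scoped Topology

noncomputable section

namespace FractalIndex

/-- `X 0`, `X 1` are the two components of a stationary, centred, jointly Gaussian process indexed
by `ℝ`, whose matrix-valued covariance function is `C i j t = E[X i s * X j (s + t)]`. -/
structure IsStationaryGaussian {Ω : Type*} [MeasurableSpace Ω] (P : Measure Ω)
    (X : Fin 2 → ℝ → Ω → ℝ) (C : Fin 2 → Fin 2 → ℝ → ℝ) : Prop where
  gaussian : IsGaussianProcess (fun p : Fin 2 × ℝ => X p.1 p.2) P
  mean_zero : ∀ i t, ∫ ω, X i t ω ∂P = 0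
  covariance : ∀ i j s t, ∫ ω, X i s ω * X j (s + t) ω ∂P = C i j t

/-- The real parameters of the model. `α i`, `c i`, `β i`, `σ i` belong to the `i`-th component
(double index `ii`), while `α₁₂`, `c₁₂`, `β₁₂`, `ρ` belong to the cross-covariance. -/
structure Params where
  α : Fin 2 → ℝ
  c : Fin 2 → ℝ
  β : Fin 2 → ℝ
  σ : Fin 2 → ℝ
  α₁₂ : ℝ
  c₁₂ : ℝ
  β₁₂ : ℝ
  ρ : ℝ

/-- Ranges of the parameters, and the restriction that makes the covariance model valid. -/
structure Params.Admissible (p : Params) : Prop where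
  α_pos : ∀ i, 0 < p.α i
  α_lt_two : ∀ i, p.α i < 2
  c_pos : ∀ i, 0 < p.c i
  β_pos : ∀ i, 0 < p.β i
  σ_pos : ∀ i, 0 < p.σ i
  c₁₂_pos : 0 < p.c₁₂
  β₁₂_pos : 0 < p.β₁₂
  ρ_pos : 0 < |p.ρ|
  ρ_lt_one : |p.ρ| < 1
  valid : (p.α 0 + p.α 1) / 2 < p.α₁₂ ∨
    ((p.α 0 + p.α 1) / 2 = p.α₁₂ ∧
      p.c₁₂ ^ 2 * p.ρ ^ 2 * p.σ 0 ^ 2 * p.σ 1 ^ 2 < p.c 0 * p.c 1)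

/-- Behaviour of the covariance functions at the origin, with polynomial remainder terms,
for admissible parameters. -/
structure CovarianceExpansion (p : Params) (C : Fin 2 → Fin 2 → ℝ → ℝ) : Prop where
  admissible : p.Admissible
  diag : ∀ i, (fun t : ℝ => C i i t - (p.σ i ^ 2 - p.c i * |t| ^ p.α i))
    =O[𝓝 0] fun t : ℝ => |t| ^ (p.α i + p.β i)
  cross_symm : C 0 1 =ᶠ[𝓝 0] C 1 0
  cross : (fun t : ℝ => C 0 1 t - p.ρ * p.σ 0 * p.σ 1 * (1 - p.c₁₂ * |t| ^ p.α₁₂))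
    =O[𝓝 0] fun t : ℝ => |t| ^ (p.α₁₂ + p.β₁₂)

/-- `a! / (a - 4)! = a (a - 1) (a - 2) (a - 3)`. -/
def fallingFour (a : ℝ) : ℝ := a * (a - 1) * (a - 2) * (a - 3)

/-- The covariance functions have a fourth derivative away from the origin, whose behaviour at
the origin is the one obtained by formally differentiating the expansion of `C i j`. -/
structure FourthDerivativeCondition (p : Params) (C : Fin 2 → Fin 2 → ℝ → ℝ) : Prop where
  differentiable : ∀ i j, ∀ k < 4, ∀ t : ℝ, t ≠ 0 → DifferentiableAt ℝ (iteratedDeriv k (C i j)) t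
  diag : ∀ i, (fun t : ℝ => iteratedDeriv 4 (C i i) t -
      (-(p.c i * fallingFour (p.α i)) * |t| ^ (p.α i - 4)))
    =o[𝓝[≠] 0] fun t : ℝ => |t| ^ (p.α i - 4)
  cross : ∀ i j, i ≠ j → (fun t : ℝ => iteratedDeriv 4 (C i j) t -
      (-(p.ρ * p.σ 0 * p.σ 1 * (p.c₁₂ * fallingFour p.α₁₂)) * |t| ^ (p.α₁₂ - 4)))
    =o[𝓝[≠] 0] fun t : ℝ => |t| ^ (p.α₁₂ - 4)

section Estimators

variable {Ω : Type*}

/-- The normalised second difference, with dilation `u`, at the grid point `j / n`, of a real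
process `x` with fractal index `a`. -/
def Y (a : ℝ) (x : ℝ → Ω → ℝ) (n u j : ℕ) (ω : Ω) : ℝ :=
  (n : ℝ) ^ (a / 2) *
    (x (((j : ℝ) - u) / n) ω - 2 * x ((j : ℝ) / n) ω + x (((j : ℝ) + u) / n) ω)

/-- The average of the squared second differences. -/
def Zbar (a : ℝ) (x : ℝ → Ω → ℝ) (n u : ℕ) (ω : Ω) : ℝ :=
  (1 / (n : ℝ)) * ∑ j ∈ Finset.Icc 1 n, Y a x n u j ω ^ 2

/-- The increment-based estimator of the fractal index, with weights `L 1, …, L m`. -/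
def alphaHat (a : ℝ) (x : ℝ → Ω → ℝ) (m : ℕ) (L : ℕ → ℝ) (n : ℕ) (ω : Ω) : ℝ :=
  ∑ u ∈ Finset.Icc 1 m, L u * Real.log (Zbar a x n u ω)

end Estimators

/-- The conditions on the weights of a linear estimator. -/
def IsWeight (m : ℕ) (L : ℕ → ℝ) : Prop :=
  ∑ u ∈ Finset.Icc 1 m, L u = 0 ∧ ∑ u ∈ Finset.Icc 1 m, L u * Real.log u = 1

/-- The product of the errors of the `i`-th and the `j`-th estimator. -/
def errorProduct {Ω : Type*} (p : Params) (X : Fin 2 → ℝ → Ω → ℝ) (m : ℕ) (L : Fin 2 → ℕ → ℝ)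
    (n : ℕ) (i j : Fin 2) (ω : Ω) : ℝ :=
  (alphaHat (p.α i) (X i) m (L i) n ω - p.α i) * (alphaHat (p.α j) (X j) m (L j) n ω - p.α j)

/-- The mean square error matrix of the pair of estimators. -/
def mseMatrix {Ω : Type*} [MeasurableSpace Ω] (P : Measure Ω) (p : Params)
    (X : Fin 2 → ℝ → Ω → ℝ) (m : ℕ) (L : Fin 2 → ℕ → ℝ) (n : ℕ) : Matrix (Fin 2) (Fin 2) ℝ :=
  Matrix.of fun i j => ∫ ω, errorProduct p X m L n i j ω ∂P

/-- `ψ(x, y) = min {1 + x, 1 + y, x + y}`. -/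
def psi (x y : ℝ) : ℝ := min (1 + x) (min (1 + y) (x + y))

end FractalIndex

end

namespace FractalIndex

/-! Almost surely, each estimation error is a deterministic `bias`, built from the logarithms of
E[`Zbar`], plus a random `fluct`, a weighted sum of logarithms of `normZbar`, that is, of `Zbar`
divided by its expectation. That expectation is `limitVar * u ^ α` up to O(n^{-β}), and the weight
conditions extract exactly α from its logarithm, so the bias is O(n^{-β}) (`isBigO_bias`). In the
product of two errors the purely random term has mean E[F_i F_j]; the other terms are a bias times
E[F] and a product of two biases. Since E[F] = O(1/n), they have exponents 1 + β_j, 1 + β_i and β_i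
+ β_j, whose minimum is `psi`.

For the random term, W = `normZbar` - 1 is a centred Gaussian quadratic form, and its moments are
governed by the sum of the squared correlations of the second differences. Each correlation is a
fourth-order difference of a covariance function at lag h/n, so mean value arguments give a decay in
h that is square summable (`exists_bound_secondDiff_secondDiff`). Hence E[W^2] = O(1/n) and, after
diagonalising the covariance matrix, E[W^4] = O(1/n^2) (`isConcentrated_mean_sq`).

The logarithm is unbounded near 0, so replacing log(1 + W) by W also uses a negative moment, E[(1 +
W)^{-1/4}] = O(n^{1/4}). The error made in E[log(1 + W) log(1 + W')] is O(n^{-9/8}). What remains is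
E[W W'], which is always O(1/n). If α₁₂ exceeds the mean of the two indices, the cross-correlations
carry a further negative power of n and E[W W'] = o(1/n). -/

/-! ### Iterated second differences and their decay. -/

/-- The symmetric second difference of `f` at `t`, with step `a`. -/
noncomputable def secondDiff (f : ℝ → ℝ) (a t : ℝ) : ℝ := f (t - a) - 2 * f t + f (t + a)

/-- The mean value theorem is applied to `s ↦ f (s + a) - f s` on `[t - a, t]`, then to `f₁` on an
interval of length `a`. No continuity of `f₂` is required. -/
theorem exists_secondDiff_eq {f f₁ f₂ : ℝ → ℝ} {a t : ℝ} (ha : 0 < a)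
    (h₁ : ∀ x ∈ Set.Icc (t - a) (t + a), HasDerivAt f (f₁ x) x)
    (h₂ : ∀ x ∈ Set.Icc (t - a) (t + a), HasDerivAt f₁ (f₂ x) x) :
    ∃ η ∈ Set.Ioo (t - a) (t + a), secondDiff f a t = a ^ 2 * f₂ η := by
  have hg : ∀ x ∈ Set.Icc (t - a) t,
      HasDerivAt (fun s => f (s + a) - f s) (f₁ (x + a) - f₁ x) x := fun x hx =>
    ((h₁ (x + a) ⟨by linarith [hx.1], by linarith [hx.2]⟩).comp_add_const x a).sub
      (h₁ x ⟨hx.1, by linarith [hx.2]⟩)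
  obtain ⟨ξ, hξ, e₁⟩ := exists_hasDerivAt_eq_slope (fun s => f (s + a) - f s)
    (fun x => f₁ (x + a) - f₁ x) (show t - a < t by linarith)
    (fun x hx => (hg x hx).continuousAt.continuousWithinAt)
    (fun x hx => hg x ⟨hx.1.le, hx.2.le⟩)
  have hξ' : ∀ x ∈ Set.Icc ξ (ξ + a), x ∈ Set.Icc (t - a) (t + a) := fun x hx =>
    ⟨by linarith [hx.1, hξ.1], by linarith [hx.2, hξ.2]⟩
  obtain ⟨η, hη, e₂⟩ := exists_hasDerivAt_eq_slope f₁ f₂ (show ξ < ξ + a by linarith)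
    (fun x hx => (h₂ x (hξ' x hx)).continuousAt.continuousWithinAt)
    (fun x hx => h₂ x (hξ' x ⟨hx.1.le, hx.2.le⟩))
  refine ⟨η, ⟨by linarith [hη.1, hξ.1], by linarith [hη.2, hξ.2]⟩, ?_⟩
  rw [eq_div_iff (by linarith)] at e₁ e₂
  rw [← e₂] at e₁
  simp only [sub_add_cancel] at e₁
  simp only [secondDiff]
  linear_combination -e₁

theorem HasDerivAt.secondDiff {f f₁ : ℝ → ℝ} {b t : ℝ} (h₁ : HasDerivAt f (f₁ (t - b)) (t - b))
    (h₂ : HasDerivAt f (f₁ t) t) (h₃ : HasDerivAt f (f₁ (t + b)) (t + b)) :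
    HasDerivAt (secondDiff f b) (FractalIndex.secondDiff f₁ b t) t :=
  ((h₁.comp_sub_const t b).sub (h₂.const_mul 2)).add (h₃.comp_add_const t b)

theorem hasDerivAt_iteratedDeriv {f : ℝ → ℝ}
    (hd : ∀ k < 4, ∀ t : ℝ, t ≠ 0 → DifferentiableAt ℝ (iteratedDeriv k f) t)
    {k : ℕ} (hk : k < 4) {t : ℝ} (ht : 0 < t) :
    HasDerivAt (iteratedDeriv k f) (iteratedDeriv (k + 1) f t) t := by
  rw [iteratedDeriv_succ]
  exact (hd k hk t ht.ne').hasDerivAt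

/-- Only the outer difference is converted into derivatives, so that the inner one can be bounded by
either the fourth or the third derivative. -/
theorem exists_secondDiff_secondDiff_eq {f : ℝ → ℝ}
    (hd : ∀ k < 4, ∀ t : ℝ, t ≠ 0 → DifferentiableAt ℝ (iteratedDeriv k f) t)
    {a b t : ℝ} (ha : 0 < a) (hb : 0 < b) (ht : 0 < t - a - b) :
    ∃ η ∈ Set.Ioo (t - a) (t + a),
      secondDiff (secondDiff f b) a t = a ^ 2 * secondDiff (iteratedDeriv 2 f) b η := by
  have key : ∀ k < 4, ∀ x ∈ Set.Icc (t - a) (t + a),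
      HasDerivAt (secondDiff (iteratedDeriv k f) b)
        (secondDiff (iteratedDeriv (k + 1) f) b x) x := fun k hk x hx => by
    have := hx.1
    exact HasDerivAt.secondDiff (hasDerivAt_iteratedDeriv hd hk (by linarith))
      (hasDerivAt_iteratedDeriv hd hk (by linarith)) (hasDerivAt_iteratedDeriv hd hk (by linarith))
  have h0 := key 0 (by norm_num)
  rw [iteratedDeriv_zero] at h0
  exact exists_secondDiff_eq ha h0 (key 1 (by norm_num))

theorem abs_secondDiff_secondDiff_le_of_fourth {f : ℝ → ℝ}
    (hd : ∀ k < 4, ∀ t : ℝ, t ≠ 0 → DifferentiableAt ℝ (iteratedDeriv k f) t)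
    {a b t M : ℝ} (ha : 0 < a) (hb : 0 < b) (ht : 0 < t - a - b)
    (hM : ∀ x ∈ Set.Ioo (t - a - b) (t + a + b), |iteratedDeriv 4 f x| ≤ M) :
    |secondDiff (secondDiff f b) a t| ≤ a ^ 2 * b ^ 2 * M := by
  obtain ⟨η, hη, e⟩ := exists_secondDiff_secondDiff_eq hd ha hb ht
  obtain ⟨ξ, hξ, e'⟩ := exists_secondDiff_eq (f := iteratedDeriv 2 f) (t := η) hb
    (fun x hx => hasDerivAt_iteratedDeriv hd (k := 2) (by norm_num) (by linarith [hη.1, hx.1]))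
    (fun x hx => hasDerivAt_iteratedDeriv hd (k := 3) (by norm_num) (by linarith [hη.1, hx.1]))
  rw [e, e', abs_mul, abs_mul, abs_of_nonneg (sq_nonneg a), abs_of_nonneg (sq_nonneg b), mul_assoc]
  gcongr
  exact hM ξ ⟨by linarith [hη.1, hξ.1], by linarith [hη.2, hξ.2]⟩

/-- One power of the step weaker than the bound by the fourth derivative. It serves lags away from
the origin, where the fourth derivative exists but may be locally unbounded. -/
theorem abs_secondDiff_secondDiff_le_of_third {f : ℝ → ℝ}
    (hd : ∀ k < 4, ∀ t : ℝ, t ≠ 0 → DifferentiableAt ℝ (iteratedDeriv k f) t)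
    {a b t M : ℝ} (ha : 0 < a) (hb : 0 < b) (ht : 0 < t - a - b)
    (hM : ∀ x ∈ Set.Ioo (t - a - b) (t + a + b), |iteratedDeriv 3 f x| ≤ M) :
    |secondDiff (secondDiff f b) a t| ≤ a ^ 2 * (2 * b * M) := by
  obtain ⟨η, hη, e⟩ := exists_secondDiff_secondDiff_eq hd ha hb ht
  have step : ∀ x y, x < y → y - x = b → t - a - b < x → y < t + a + b →
      |iteratedDeriv 2 f y - iteratedDeriv 2 f x| ≤ b * M := fun x y hxy hb' hx hy => by
    have hder : ∀ z ∈ Set.Icc x y, HasDerivAt (iteratedDeriv 2 f) (iteratedDeriv 3 f z) z :=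
      fun z hz => hasDerivAt_iteratedDeriv hd (k := 2) (by norm_num) (by linarith [hz.1])
    obtain ⟨ξ, hξ, e⟩ := exists_hasDerivAt_eq_slope _ (iteratedDeriv 3 f) hxy
      (fun z hz => (hder z hz).continuousAt.continuousWithinAt)
      (fun z hz => hder z ⟨hz.1.le, hz.2.le⟩)
    rw [eq_div_iff (by linarith), hb'] at e
    rw [← e, abs_mul, abs_of_pos hb, mul_comm]
    gcongr
    exact hM ξ ⟨by linarith [hξ.1], by linarith [hξ.2]⟩
  rw [e, abs_mul, abs_of_nonneg (sq_nonneg a)]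
  gcongr
  have h1 := step (η - b) η (by linarith) (by ring) (by linarith [hη.1]) (by linarith [hη.2])
  have h2 := step η (η + b) (by linarith) (by ring) (by linarith [hη.1]) (by linarith [hη.2])
  rw [abs_le] at h1 h2 ⊢
  simp only [secondDiff]
  constructor <;> linarith [h1.1, h1.2, h2.1, h2.2]

/-- The decay profile of the correlations of the second differences. -/
noncomputable def decay (m h : ℕ) : ℝ := if h ≤ 2 * m then 1 else ((h : ℝ) - 2 * m) ^ (-(3 / 4) : ℝ)

theorem decay_nonneg (m h : ℕ) : 0 ≤ decay m h := by
  unfold decay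
  split_ifs with hh
  · exact zero_le_one
  · have : ((2 * m : ℕ) : ℝ) ≤ h := by exact_mod_cast (not_le.1 hh).le
    push_cast at this
    exact Real.rpow_nonneg (by linarith) _

/-- The differences annihilate the constant `c₀`, and the absolute coefficients of the nine values
sum to (1 + 2 + 1)^2 = 16. -/
theorem abs_secondDiff_secondDiff_le_of_near {f : ℝ → ℝ} {c₀ a K x y t s : ℝ} (ha : 0 ≤ a)
    (hK : 0 ≤ K) (hf : ∀ z, |z| ≤ s → |f z - c₀| ≤ K * |z| ^ a) (hx : 0 ≤ x) (hy : 0 ≤ y)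
    (ht : 0 ≤ t) (hs : x + y + t ≤ s) :
    |secondDiff (secondDiff f y) x t| ≤ 16 * (K * s ^ a) := by
  have hb : ∀ z, -(x + y) ≤ z → z ≤ t + (x + y) → |f z - c₀| ≤ K * s ^ a := fun z h1 h2 => by
    have hz : |z| ≤ s := abs_le.2 ⟨by linarith, by linarith⟩
    exact (hf z hz).trans (by gcongr)
  have b1 := abs_le.1 (hb (t - x - y) (by linarith) (by linarith))
  have b2 := abs_le.1 (hb (t - x) (by linarith) (by linarith))
  have b3 := abs_le.1 (hb (t - x + y) (by linarith) (by linarith))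
  have b4 := abs_le.1 (hb (t - y) (by linarith) (by linarith))
  have b5 := abs_le.1 (hb t (by linarith) (by linarith))
  have b6 := abs_le.1 (hb (t + y) (by linarith) (by linarith))
  have b7 := abs_le.1 (hb (t + x - y) (by linarith) (by linarith))
  have b8 := abs_le.1 (hb (t + x) (by linarith) (by linarith))
  have b9 := abs_le.1 (hb (t + x + y) (by linarith) (by linarith))
  simp only [secondDiff]
  rw [abs_le]
  constructor <;> linarith [b1.1, b1.2, b2.1, b2.2, b3.1, b3.2, b4.1, b4.2, b5.1, b5.2, b6.1, b6.2,
    b7.1, b7.2, b8.1, b8.2, b9.1, b9.2]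

/-- Three regimes of the lag: overlapping stencils (`h ≤ 2 * m`), where only the size of `f - c₀`
near 0 matters; small lags, through the fourth derivative, with decay `r ^ (a - 4)`; remaining lags,
through the third derivative, with a factor `n ^ (-3)`. The last is at most `n ^ (-a) * r ^ (-3/4)`
exactly because `a ≤ 9 / 4`, and squares of `r ^ (-3/4)` are summable. -/
theorem exists_bound_secondDiff_secondDiff {f : ℝ → ℝ} {c₀ a : ℝ} (ha : 0 < a) (ha' : a ≤ 9 / 4)
    (h₀ : (fun t => f t - c₀) =O[𝓝 0] fun t : ℝ => |t| ^ a)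
    (hd : ∀ k < 4, ∀ t : ℝ, t ≠ 0 → DifferentiableAt ℝ (iteratedDeriv k f) t)
    (h₄ : iteratedDeriv 4 f =O[𝓝[≠] 0] fun t : ℝ => |t| ^ (a - 4)) (m : ℕ) :
    ∃ K : ℝ, 0 ≤ K ∧ ∀ᶠ n : ℕ in atTop, ∀ u ∈ Finset.Icc 1 m, ∀ v ∈ Finset.Icc 1 m, ∀ h ≤ n,
      |secondDiff (secondDiff f ((v : ℝ) / n)) ((u : ℝ) / n) ((h : ℝ) / n)| ≤
        K * (n : ℝ) ^ (-a) * decay m h := by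
  obtain ⟨K₀, hK₀, h₀⟩ := h₀.exists_pos
  obtain ⟨K₄, hK₄, h₄⟩ := h₄.exists_pos
  obtain ⟨δ₀, hδ₀, h₀⟩ := Metric.eventually_nhds_iff.1 h₀.bound
  obtain ⟨δ, hδ, h₄⟩ := Metric.eventually_nhds_iff.1 (eventually_nhdsWithin_iff.1 h₄.bound)
  -- The third derivative is differentiable off 0, hence continuous, hence bounded on a compact set
  -- avoiding 0.
  have hc : ContinuousOn (iteratedDeriv 3 f) (Set.Icc (δ / 2) 2) := fun t ht =>
    (hd 3 (by norm_num) t (by linarith [ht.1])).continuousAt.continuousWithinAt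
  obtain ⟨K₃, hK₃⟩ := isCompact_Icc.exists_bound_of_continuousOn hc
  have hm0 : (0 : ℝ) ≤ m := m.cast_nonneg
  refine ⟨16 * (K₀ * (4 * m) ^ a) + (m : ℝ) ^ 4 * K₄ + 2 * (m : ℝ) ^ 3 * |K₃|, by positivity, ?_⟩
  -- A stencil has width at most `4 * m / n`. Past `N₁`, stencils with `h ≤ 2 * m` stay in the range
  -- of the expansion; past `N₂`, a stencil whose top is at least `δ` stays above `δ / 2`.
  obtain ⟨N₁, hN₁⟩ := exists_nat_gt (4 * m / δ₀)
  obtain ⟨N₂, hN₂⟩ := exists_nat_gt (8 * m / δ)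
  filter_upwards [eventually_ge_atTop N₁, eventually_ge_atTop N₂, eventually_ge_atTop (2 * m),
    eventually_ge_atTop 1] with n hn₁ hn₂ hn₃ hn₄ u hu v hv h hh
  have hn : (0 : ℝ) < n := by exact_mod_cast hn₄
  obtain ⟨hu1, hum⟩ := Finset.mem_Icc.1 hu
  obtain ⟨hv1, hvm⟩ := Finset.mem_Icc.1 hv
  have hu1' : (1 : ℝ) ≤ u := by exact_mod_cast hu1
  have hv1' : (1 : ℝ) ≤ v := by exact_mod_cast hv1
  have hum' : (u : ℝ) ≤ m := by exact_mod_cast hum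
  have hvm' : (v : ℝ) ≤ m := by exact_mod_cast hvm
  have hh' : (h : ℝ) ≤ n := by exact_mod_cast hh
  have hn₃' : 2 * (m : ℝ) ≤ n := by exact_mod_cast hn₃
  have hd₀ : 4 * (m : ℝ) / n < δ₀ := by
    rw [div_lt_iff₀ hn]
    rw [div_lt_iff₀ hδ₀] at hN₁
    have : (N₁ : ℝ) ≤ n := by exact_mod_cast hn₁
    nlinarith
  have hd₄ : 8 * (m : ℝ) / n < δ := by
    rw [div_lt_iff₀ hn]
    rw [div_lt_iff₀ hδ] at hN₂
    have : (N₂ : ℝ) ≤ n := by exact_mod_cast hn₂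
    nlinarith
  have hna : 0 < (n : ℝ) ^ (-a) := Real.rpow_pos_of_pos hn _
  by_cases hh2 : h ≤ 2 * m
  · have hh2' : (h : ℝ) ≤ 2 * m := by exact_mod_cast hh2
    have := abs_secondDiff_secondDiff_le_of_near (f := f) (c₀ := c₀) (x := u / n) (y := v / n)
      (t := h / n) (s := 4 * m / n) ha.le hK₀.le (fun z hz => by
        have := h₀ (y := z) (by simpa using hz.trans_lt hd₀)
        rwa [Real.norm_eq_abs, Real.norm_of_nonneg (by positivity)] at this)
      (by positivity) (by positivity) (by positivity)
      (by rw [← add_div, ← add_div]; gcongr; linarith)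
    have e : (4 * (m : ℝ) / n) ^ a = (4 * m) ^ a * (n : ℝ) ^ (-a) := by
      rw [Real.div_rpow (by positivity) hn.le, Real.rpow_neg hn.le, div_eq_mul_inv]
    rw [e] at this
    rw [decay, if_pos hh2, mul_one]
    refine this.trans ?_
    rw [← mul_assoc K₀, ← mul_assoc]
    gcongr
    have : 0 ≤ (m : ℝ) ^ 4 * K₄ + 2 * (m : ℝ) ^ 3 * |K₃| := by positivity
    linarith
  · have hr1 : (1 : ℝ) ≤ (h : ℝ) - 2 * m := by
      have : ((2 * m + 1 : ℕ) : ℝ) ≤ h := by exact_mod_cast not_le.1 hh2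
      push_cast at this; linarith
    set r : ℝ := (h : ℝ) - 2 * m with hr
    have hrn : r ≤ n := by linarith
    rw [decay, if_neg hh2, ← hr]
    have hlow : r / n ≤ (h : ℝ) / n - u / n - v / n := by
      rw [← sub_div, ← sub_div]; gcongr; linarith
    have hrn0 : 0 < r / n := by positivity
    have hup : (h : ℝ) / n + u / n + v / n ≤ (h : ℝ) / n - u / n - v / n + 4 * (m : ℝ) / n := by
      rw [← sub_div, ← sub_div, ← add_div, ← add_div, ← add_div]
      exact div_le_div_of_nonneg_right (by linarith) hn.le
    have hle2 : (h : ℝ) / n + u / n + v / n ≤ 2 := by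
      rw [← add_div, ← add_div, div_le_iff₀ hn]; linarith
    have h8 : 8 * (m : ℝ) / n = 2 * (4 * m / n) := by ring
    have hrp : 0 ≤ r ^ (-(3 / 4) : ℝ) := Real.rpow_nonneg (by linarith) _
    have hun : (u : ℝ) / n ≤ m / n := by gcongr
    have hvn : (v : ℝ) / n ≤ m / n := by gcongr
    by_cases hcase : (h : ℝ) / n + u / n + v / n < δ
    · have := abs_secondDiff_secondDiff_le_of_fourth hd (a := u / n) (b := v / n) (t := h / n)
        (M := K₄ * (r / n) ^ (a - 4)) (by positivity) (by positivity) (by linarith)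
        (fun x hx => by
          have hx0 : 0 < x := by linarith [hx.1]
          have hxd : |x| < δ := by rw [abs_of_pos hx0]; linarith [hx.2]
          have := h₄ (y := x) (by simpa using hxd) hx0.ne'
          rw [Real.norm_eq_abs, Real.norm_of_nonneg (by positivity), abs_of_pos hx0] at this
          refine this.trans ?_
          gcongr ?_ * ?_
          exact Real.rpow_le_rpow_of_nonpos hrn0 (by linarith [hx.1]) (by linarith))
      refine this.trans ?_
      have e : ((m : ℝ) / n) ^ 2 * (m / n) ^ 2 * (K₄ * (r / n) ^ (a - 4)) =
          (m : ℝ) ^ 4 * K₄ * (n : ℝ) ^ (-a) * r ^ (a - 4) := by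
        have : (n : ℝ) ^ (-a) = ((n : ℝ) ^ 4)⁻¹ * ((n : ℝ) ^ (a - 4))⁻¹ := by
          rw [← mul_inv, ← Real.rpow_natCast, ← Real.rpow_add hn, ← Real.rpow_neg hn.le]
          norm_num
        rw [Real.div_rpow (by linarith) hn.le, this]
        field_simp
      calc _ ≤ ((m : ℝ) / n) ^ 2 * (m / n) ^ 2 * (K₄ * (r / n) ^ (a - 4)) := by gcongr
        _ = _ := e
        _ ≤ (m : ℝ) ^ 4 * K₄ * (n : ℝ) ^ (-a) * r ^ (-(3 / 4) : ℝ) := by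
          gcongr
          linarith
        _ ≤ _ := by
          gcongr
          have : 0 ≤ 16 * (K₀ * (4 * (m : ℝ)) ^ a) + 2 * (m : ℝ) ^ 3 * |K₃| := by positivity
          linarith
    · have := abs_secondDiff_secondDiff_le_of_third hd (a := u / n) (b := v / n) (t := h / n)
        (M := |K₃|) (by positivity) (by positivity) (by linarith)
        (fun x hx => (hK₃ x ⟨by linarith [hx.1], by linarith [hx.2]⟩).trans (le_abs_self _))
      refine this.trans ?_
      have e : ((n : ℝ) ^ 3)⁻¹ = (n : ℝ) ^ (-a) * (n : ℝ) ^ (a - 3) := by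
        rw [← Real.rpow_add hn, ← Real.rpow_natCast, ← Real.rpow_neg hn.le]
        congr 1
        push_cast
        ring
      have e2 : (n : ℝ) ^ (a - 3) ≤ r ^ (-(3 / 4) : ℝ) := by
        calc (n : ℝ) ^ (a - 3) ≤ (n : ℝ) ^ (-(3 / 4) : ℝ) :=
              Real.rpow_le_rpow_of_exponent_le (by exact_mod_cast hn₄) (by linarith)
          _ ≤ _ := Real.rpow_le_rpow_of_nonpos (by linarith) hrn (by norm_num)
      calc _ ≤ ((m : ℝ) / n) ^ 2 * (2 * (m / n) * |K₃|) := by gcongr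
        _ = 2 * (m : ℝ) ^ 3 * |K₃| * ((n : ℝ) ^ 3)⁻¹ := by ring
        _ = 2 * (m : ℝ) ^ 3 * |K₃| * (n : ℝ) ^ (-a) * (n : ℝ) ^ (a - 3) := by rw [e]; ring
        _ ≤ 2 * (m : ℝ) ^ 3 * |K₃| * (n : ℝ) ^ (-a) * r ^ (-(3 / 4) : ℝ) := by gcongr
        _ ≤ _ := by
          gcongr
          have : 0 ≤ 16 * (K₀ * (4 * (m : ℝ)) ^ a) + (m : ℝ) ^ 4 * K₄ := by positivity
          linarith

/-- The squared tail has exponent -3/2 < -1; shifting by `2 * m + 1` skips the plateau. -/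
theorem summable_decay_sq (m : ℕ) : Summable fun h => decay m h ^ 2 := by
  rw [← summable_nat_add_iff (2 * m + 1)]
  have : Summable fun k : ℕ => ((k + 1 : ℕ) : ℝ) ^ (-(3 / 2) : ℝ) :=
    (summable_nat_add_iff 1).2 (Real.summable_nat_rpow.2 (by norm_num))
  refine this.congr fun k => ?_
  rw [decay, if_neg (by omega), ← Real.rpow_natCast, ← Real.rpow_mul]
  · push_cast
    congr 1 <;> ring
  · push_cast; linarith [k.cast_nonneg (α := ℝ)]

theorem sum_dist_le {g : ℕ → ℝ} (hg : ∀ h, 0 ≤ g h) (hs : Summable g) (n : ℕ) :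
    ∑ j ∈ Finset.Icc 1 n, ∑ k ∈ Finset.Icc 1 n, g (Nat.dist j k) ≤ n * (2 * ∑' h, g h) := by
  have : ∀ j ∈ Finset.Icc 1 n, ∑ k ∈ Finset.Icc 1 n, g (Nat.dist j k) ≤ 2 * ∑' h, g h := by
    intro j _
    -- On each side of `j` the distance to `j` is injective, so a row uses every value of `g` at
    -- most twice.
    rw [← Finset.sum_filter_add_sum_filter_not _ (fun k => j ≤ k), two_mul]
    have key : ∀ s : Finset ℕ, Set.InjOn (Nat.dist j) s → ∑ k ∈ s, g (Nat.dist j k) ≤ ∑' h, g h :=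
      fun s hs' => by
        rw [← Finset.sum_image (f := g) hs']
        exact hs.sum_le_tsum _ fun h _ => hg h
    refine add_le_add (key _ ?_) (key _ ?_) <;>
    · intro x hx y hy hxy
      simp only [Finset.coe_filter, Set.mem_ofPred_eq, Nat.dist] at hx hy hxy
      omega
  refine (Finset.sum_le_sum this).trans ?_
  simp

/-! ### Moments of centred Gaussian variables. -/

section Gaussian

local notation "γ" => gaussianReal 0 1

theorem integral_pow_four_stdGaussian : ∫ x, x ^ 4 ∂γ = 3 := by
  rw [integral_gaussianReal_eq_integral_smul one_ne_zero]
  have h : ∀ x : ℝ, gaussianPDFReal 0 1 x • x ^ 4 =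
      (√(2 * Real.pi))⁻¹ * (fun y : ℝ => y ^ (4 : ℝ) * Real.exp (-(1 / 2) * y ^ (2 : ℝ))) |x| := by
    intro x
    have e1 : |x| ^ (4 : ℝ) = x ^ 4 := by
      rw [show (4 : ℝ) = ((4 : ℕ) : ℝ) by norm_num, Real.rpow_natCast, Even.pow_abs (by decide)]
    have e2 : |x| ^ (2 : ℝ) = x ^ 2 := by
      rw [Real.rpow_two, sq_abs]
    simp only [gaussianPDFReal_def, smul_eq_mul, e1, e2]
    simp only [NNReal.coe_one, mul_one, sub_zero]
    rw [show -x ^ 2 / 2 = -(1 / 2) * x ^ 2 by ring]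
    ring
  simp_rw [h]
  rw [integral_const_mul, integral_comp_abs (f := fun y : ℝ =>
      y ^ (4 : ℝ) * Real.exp (-(1 / 2) * y ^ (2 : ℝ))),
    integral_rpow_mul_exp_neg_mul_rpow (by norm_num) (by norm_num) (by norm_num)]
  have hG : Real.Gamma ((4 + 1) / 2) = 3 / 4 * √Real.pi := by
    rw [show ((4 : ℝ) + 1) / 2 = (1 / 2 + 1) + 1 by norm_num, Real.Gamma_add_one (by norm_num),
      Real.Gamma_add_one (by norm_num), Real.Gamma_one_half_eq]
    ring
  have hp : ((1 : ℝ) / 2) ^ (-(4 + 1) / 2 : ℝ) = 4 * √2 := by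
    rw [one_div, Real.inv_rpow (by norm_num), ← Real.rpow_neg (by norm_num),
      show -(-((4 : ℝ) + 1) / 2) = 2 + 1 / 2 by norm_num, Real.rpow_add (by norm_num),
      ← Real.sqrt_eq_rpow]
    norm_num
  rw [hG, hp, Real.sqrt_mul (by norm_num)]
  have : √Real.pi ≠ 0 := (Real.sqrt_pos.2 Real.pi_pos).ne'
  field_simp

theorem integrable_abs_rpow_stdGaussian {s : ℝ} (hs : -1 < s) :
    Integrable (fun x : ℝ => |x| ^ s) γ := by
  have hm : Measurable fun x : ℝ => |x| ^ s := by fun_prop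
  rw [gaussianReal_of_var_ne_zero 0 one_ne_zero,
    integrable_withDensity_iff (measurable_gaussianPDF 0 1)
      (ae_of_all _ fun _ => gaussianPDF_lt_top)]
  -- For negative `x`, `x ^ s` is not `|x| ^ s`; the integrand is therefore dominated by the norm of
  -- this function plus that of its reflection.
  have h := integrable_rpow_mul_exp_neg_mul_sq (b := 1 / 2) (by norm_num) hs
  refine ((h.norm.add h.comp_neg.norm).const_mul (√(2 * Real.pi))⁻¹).mono'
    (hm.mul (measurable_gaussianPDF 0 1).ennreal_toReal).aestronglyMeasurable
    (ae_of_all _ fun x => ?_)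
  have e : (gaussianPDF 0 1 x).toReal = (√(2 * Real.pi))⁻¹ * Real.exp (-(1 / 2) * x ^ 2) := by
    rw [toReal_gaussianPDF, gaussianPDFReal_def]
    beta_reduce
    rw [NNReal.coe_one, mul_one, sub_zero, mul_one, show -x ^ 2 / 2 = -(1 / 2) * x ^ 2 by ring]
  rw [e, norm_mul, Real.norm_of_nonneg (by positivity), Real.norm_of_nonneg (by positivity),
    mul_left_comm]
  refine mul_le_mul_of_nonneg_left ?_ (by positivity)
  simp only [Pi.add_apply, norm_mul, Real.norm_of_nonneg (Real.exp_pos _).le, neg_sq]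
  rw [← add_mul]
  refine mul_le_mul_of_nonneg_right ?_ (by positivity)
  rcases le_total 0 x with hx | hx
  · rw [abs_of_nonneg hx]
    exact (le_abs_self _).trans (le_add_of_nonneg_right (norm_nonneg _))
  · rw [abs_of_nonpos hx]
    exact (le_abs_self _).trans (le_add_of_nonneg_left (norm_nonneg _))

variable {Ω : Type*} [MeasurableSpace Ω] {P : Measure Ω}

theorem integrable_pow_of_memLp {f : Ω → ℝ} {k : ℕ} (hk : k ≠ 0) (hf : MemLp f k P) :
    Integrable (fun ω => f ω ^ k) P := by
  refine (hf.integrable_norm_pow hk).congr' (hf.1.pow k) (ae_of_all _ fun ω => ?_)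
  simp

section Centred

variable {X : Ω → ℝ}

theorem integrable_pow_of_gaussian (hX : HasGaussianLaw X P) (k : ℕ) :
    Integrable (fun ω => X ω ^ k) P := by
  have := hX.isProbabilityMeasure
  rcases eq_or_ne k 0 with rfl | hk
  · simp
  · exact integrable_pow_of_memLp hk (hX.memLp (by simp))

/-- Scaling a standard Gaussian variable includes the degenerate case of variance zero and reduces
all moments to standard ones. -/
theorem map_eq_of_centred (hX : HasGaussianLaw X P) (h0 : ∫ ω, X ω ∂P = 0) :
    P.map X = (γ).map fun x => √(∫ ω, X ω ^ 2 ∂P) * x := by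
  rw [hX.map_eq_gaussianReal, gaussianReal_map_const_mul, h0, mul_zero]
  congr 1
  rw [variance_eq_integral hX.aemeasurable, h0]
  ext
  simp only [sub_zero, mul_one]
  rw [Real.coe_toNNReal _ (integral_nonneg fun ω => sq_nonneg _)]
  exact (Real.sq_sqrt (integral_nonneg fun ω => sq_nonneg _)).symm

theorem integral_comp_of_centred (hX : HasGaussianLaw X P) (h0 : ∫ ω, X ω ∂P = 0) {f : ℝ → ℝ}
    (hf : Measurable f) :
    ∫ ω, f (X ω) ∂P = ∫ x, f (√(∫ ω, X ω ^ 2 ∂P) * x) ∂γ := by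
  rw [← integral_map hX.aemeasurable hf.aestronglyMeasurable, map_eq_of_centred hX h0,
    integral_map (by fun_prop) hf.aestronglyMeasurable]

theorem integrable_comp_of_centred (hX : HasGaussianLaw X P) (h0 : ∫ ω, X ω ∂P = 0) {f : ℝ → ℝ}
    (hf : Measurable f) (h : Integrable (fun x => f (√(∫ ω, X ω ^ 2 ∂P) * x)) γ) :
    Integrable (fun ω => f (X ω)) P := by
  rw [← Function.comp_def, ← integrable_map_measure hf.aestronglyMeasurable hX.aemeasurable,
    map_eq_of_centred hX h0, integrable_map_measure hf.aestronglyMeasurable (by fun_prop)]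
  exact h

theorem integral_pow_four_of_centred (hX : HasGaussianLaw X P) (h0 : ∫ ω, X ω ∂P = 0) :
    ∫ ω, X ω ^ 4 ∂P = 3 * (∫ ω, X ω ^ 2 ∂P) ^ 2 := by
  have hv : 0 ≤ ∫ ω, X ω ^ 2 ∂P := integral_nonneg fun ω => sq_nonneg _
  rw [integral_comp_of_centred hX h0 (f := fun x => x ^ 4) (by fun_prop)]
  simp_rw [mul_pow]
  rw [integral_const_mul, integral_pow_four_stdGaussian,
    show √(∫ ω, X ω ^ 2 ∂P) ^ 4 = (√(∫ ω, X ω ^ 2 ∂P) ^ 2) ^ 2 by ring, Real.sq_sqrt hv]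
  ring

theorem integral_sq_sub_pow_of_centred (hX : HasGaussianLaw X P) (h0 : ∫ ω, X ω ∂P = 0) (k : ℕ) :
    ∫ ω, (X ω ^ 2 - ∫ ω, X ω ^ 2 ∂P) ^ k ∂P =
      (∫ ω, X ω ^ 2 ∂P) ^ k * ∫ x, (x ^ 2 - 1) ^ k ∂γ := by
  have hv : 0 ≤ ∫ ω, X ω ^ 2 ∂P := integral_nonneg fun ω => sq_nonneg _
  rw [integral_comp_of_centred hX h0 (f := fun x => (x ^ 2 - ∫ ω, X ω ^ 2 ∂P) ^ k) (by fun_prop),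
    ← integral_const_mul]
  congr 1 with x
  rw [mul_pow, Real.sq_sqrt hv, ← mul_pow]
  ring

theorem ae_ne_zero_of_centred (hX : HasGaussianLaw X P) (h0 : ∫ ω, X ω ∂P = 0)
    (hv : 0 < ∫ ω, X ω ^ 2 ∂P) : ∀ᵐ ω ∂P, X ω ≠ 0 := by
  have : ∀ᵐ x ∂(P.map X), x ≠ 0 := by
    rw [map_eq_of_centred hX h0, ae_map_iff (p := fun x : ℝ => x ≠ 0) (by fun_prop)
      (measurableSet_singleton 0).compl]
    have := nullSingletonClass_gaussianReal (μ := 0) (v := 1) one_ne_zero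
    filter_upwards [Measure.ae_ne (γ) 0] with x hx
    exact mul_ne_zero (Real.sqrt_pos.2 hv).ne' hx
  exact ae_of_ae_map hX.aemeasurable this

theorem integrable_abs_rpow_of_centred (hX : HasGaussianLaw X P) (h0 : ∫ ω, X ω ∂P = 0) {s : ℝ}
    (hs : -1 < s) : Integrable (fun ω => |X ω| ^ s) P := by
  refine integrable_comp_of_centred hX h0 (f := fun x => |x| ^ s) (by fun_prop) ?_
  simp_rw [abs_mul, Real.mul_rpow (abs_nonneg _) (abs_nonneg _)]
  exact (integrable_abs_rpow_stdGaussian hs).const_mul _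

theorem integral_abs_rpow_of_centred (hX : HasGaussianLaw X P) (h0 : ∫ ω, X ω ∂P = 0) (s : ℝ) :
    ∫ ω, |X ω| ^ s ∂P = √(∫ ω, X ω ^ 2 ∂P) ^ s * ∫ x, |x| ^ s ∂γ := by
  rw [integral_comp_of_centred hX h0 (f := fun x => |x| ^ s) (by fun_prop)]
  simp_rw [abs_mul, Real.mul_rpow (abs_nonneg _) (abs_nonneg _)]
  rw [integral_const_mul, abs_of_nonneg (Real.sqrt_nonneg _)]

end Centred

/-- Isserlis' formula by polarisation: 12 X²Y² = (X + Y)⁴ + (X - Y)⁴ - 2X⁴ - 2Y⁴, and each fourth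
power is that of a centred Gaussian variable. -/
theorem integral_sq_mul_sq_of_gaussian {X Y : Ω → ℝ}
    (h : HasGaussianLaw (fun ω => (X ω, Y ω)) P) (hX0 : ∫ ω, X ω ∂P = 0) (hY0 : ∫ ω, Y ω ∂P = 0) :
    ∫ ω, X ω ^ 2 * Y ω ^ 2 ∂P =
      (∫ ω, X ω ^ 2 ∂P) * (∫ ω, Y ω ^ 2 ∂P) + 2 * (∫ ω, X ω * Y ω ∂P) ^ 2 := by
  have hX := h.fst
  have hY := h.snd
  have hA := h.fun_add
  have hS := h.fun_sub
  have iX2 := integrable_pow_of_gaussian hX 2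
  have iY2 := integrable_pow_of_gaussian hY 2
  have iX4 := integrable_pow_of_gaussian hX 4
  have iY4 := integrable_pow_of_gaussian hY 4
  have iA4 := integrable_pow_of_gaussian hA 4
  have iS4 := integrable_pow_of_gaussian hS 4
  have iXY : Integrable (fun ω => X ω * Y ω) P := hX.memLp_two.integrable_mul hY.memLp_two
  have hA0 : ∫ ω, (X ω + Y ω) ∂P = 0 := by
    rw [integral_add hX.integrable hY.integrable, hX0, hY0, add_zero]
  have hS0 : ∫ ω, (X ω - Y ω) ∂P = 0 := by
    rw [integral_sub hX.integrable hY.integrable, hX0, hY0, sub_zero]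
  have eA : ∫ ω, (X ω + Y ω) ^ 2 ∂P =
      ∫ ω, X ω ^ 2 ∂P + ∫ ω, Y ω ^ 2 ∂P + 2 * ∫ ω, X ω * Y ω ∂P := by
    rw [← integral_const_mul, ← integral_add iX2 iY2,
      ← integral_add (iX2.fun_add iY2) (iXY.const_mul 2)]
    congr 1 with ω
    ring
  have eS : ∫ ω, (X ω - Y ω) ^ 2 ∂P =
      ∫ ω, X ω ^ 2 ∂P + ∫ ω, Y ω ^ 2 ∂P - 2 * ∫ ω, X ω * Y ω ∂P := by
    rw [← integral_const_mul, ← integral_add iX2 iY2,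
      ← integral_sub (iX2.fun_add iY2) (iXY.const_mul 2)]
    congr 1 with ω
    ring
  have i3 : Integrable (fun ω => (X ω + Y ω) ^ 4 + (X ω - Y ω) ^ 4 - 2 * X ω ^ 4) P :=
    (iA4.add iS4).sub (iX4.const_mul 2)
  have e : ∫ ω, X ω ^ 2 * Y ω ^ 2 ∂P = (∫ ω, (X ω + Y ω) ^ 4 ∂P + ∫ ω, (X ω - Y ω) ^ 4 ∂P -
      2 * ∫ ω, X ω ^ 4 ∂P - 2 * ∫ ω, Y ω ^ 4 ∂P) / 12 := by
    rw [← integral_const_mul, ← integral_const_mul, ← integral_add iA4 iS4,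
      ← integral_sub (iA4.fun_add iS4) (iX4.const_mul 2),
      ← integral_sub i3 (iY4.const_mul 2), ← integral_div]
    congr 1 with ω
    ring
  rw [e, integral_pow_four_of_centred hA hA0, integral_pow_four_of_centred hS hS0,
    integral_pow_four_of_centred hX hX0, integral_pow_four_of_centred hY hY0, eA, eS]
  ring

/-! ### Second and fourth moments of Gaussian quadratic forms. -/

/-- When a summand is added, independence and centring kill every term with an odd power of it or of
the partial sum S. The surviving mixed term 6 E[S²] E[ξ²] is absorbed by `3 * a ^ 2` times the
double product in the square of the sum of `l`. -/
theorem integral_sum_pow_le_of_iIndepFun [IsProbabilityMeasure P] {ι : Type*} {ξ : ι → Ω → ℝ}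
    (hξ : iIndepFun ξ P) (hL : ∀ i, ∀ k : ℕ, MemLp (ξ i) k P) (h0 : ∀ i, ∫ ω, ξ i ω ∂P = 0)
    {l : ι → ℝ} (hl : ∀ i, 0 ≤ l i) {a b : ℝ} (ha : 0 ≤ a) (hb : 0 ≤ b)
    (h2 : ∀ i, ∫ ω, ξ i ω ^ 2 ∂P ≤ a * l i) (h4 : ∀ i, ∫ ω, ξ i ω ^ 4 ∂P ≤ b * l i ^ 2)
    (s : Finset ι) :
    ∫ ω, (∑ i ∈ s, ξ i ω) ∂P = 0 ∧ ∫ ω, (∑ i ∈ s, ξ i ω) ^ 2 ∂P ≤ a * ∑ i ∈ s, l i ∧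
      ∫ ω, (∑ i ∈ s, ξ i ω) ^ 4 ∂P ≤ (3 * a ^ 2 + b) * (∑ i ∈ s, l i) ^ 2 := by
  classical
  induction s using Finset.induction_on with
  | empty => simp
  | insert i s hi ih =>
    obtain ⟨i1, i2, i4⟩ := ih
    simp only [Finset.sum_insert hi]
    set S : Ω → ℝ := fun ω => ∑ j ∈ s, ξ j ω with hS
    have hSL : ∀ k : ℕ, MemLp S k P := fun k => memLp_finsetSum s fun j _ => hL j k
    have hpow : ∀ (f : Ω → ℝ), (∀ k : ℕ, MemLp f k P) → ∀ k : ℕ, Integrable (fun ω => f ω ^ k) P :=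
      fun f hf k => by
        rcases eq_or_ne k 0 with rfl | hk
        · simp
        · exact integrable_pow_of_memLp hk (hf k)
    have hind : IndepFun S (ξ i) P := by
      have := hξ.indepFun_finsetSum_of_notMem₀ (fun j => (hL j 1).1.aemeasurable) hi
      convert this using 1
      ext ω
      simp [hS]
    have hmul : ∀ p q : ℕ, Integrable (fun ω => S ω ^ p * ξ i ω ^ q) P ∧
        ∫ ω, S ω ^ p * ξ i ω ^ q ∂P = (∫ ω, S ω ^ p ∂P) * ∫ ω, ξ i ω ^ q ∂P := fun p q => by
      have hc := hind.comp (φ := fun x => x ^ p) (ψ := fun x => x ^ q) (by fun_prop) (by fun_prop)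
      exact ⟨hc.integrable_mul (hpow _ hSL p) (hpow _ (hL i) q),
        hc.integral_mul_eq_mul_integral (hpow _ hSL p).1 (hpow _ (hL i) q).1⟩
    have iS := hpow _ hSL
    have iξ := hpow _ (hL i)
    have hξ0 := h0 i
    have e2 : ∫ ω, (ξ i ω + S ω) ^ 2 ∂P = ∫ ω, ξ i ω ^ 2 ∂P + ∫ ω, S ω ^ 2 ∂P := by
      have : ∀ ω, (ξ i ω + S ω) ^ 2 = ξ i ω ^ 2 + S ω ^ 2 + 2 * (S ω ^ 1 * ξ i ω ^ 1) :=
        fun ω => by ring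
      simp_rw [this]
      rw [integral_add ((iξ 2).fun_add (iS 2)) ((hmul 1 1).1.const_mul 2),
        integral_add (iξ 2) (iS 2), integral_const_mul, (hmul 1 1).2]
      simp [hξ0]
    have e4 : ∫ ω, (ξ i ω + S ω) ^ 4 ∂P = ∫ ω, ξ i ω ^ 4 ∂P + ∫ ω, S ω ^ 4 ∂P +
        6 * ((∫ ω, S ω ^ 2 ∂P) * ∫ ω, ξ i ω ^ 2 ∂P) := by
      have : ∀ ω, (ξ i ω + S ω) ^ 4 = ξ i ω ^ 4 + S ω ^ 4 + 6 * (S ω ^ 2 * ξ i ω ^ 2) +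
          4 * (S ω ^ 3 * ξ i ω ^ 1) + 4 * (S ω ^ 1 * ξ i ω ^ 3) := fun ω => by ring
      simp_rw [this]
      rw [integral_add ((((iξ 4).fun_add (iS 4)).fun_add ((hmul 2 2).1.const_mul 6)).fun_add
          ((hmul 3 1).1.const_mul 4)) ((hmul 1 3).1.const_mul 4),
        integral_add (((iξ 4).fun_add (iS 4)).fun_add ((hmul 2 2).1.const_mul 6))
          ((hmul 3 1).1.const_mul 4),
        integral_add ((iξ 4).fun_add (iS 4)) ((hmul 2 2).1.const_mul 6), integral_add (iξ 4) (iS 4),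
        integral_const_mul, integral_const_mul, integral_const_mul, (hmul 2 2).2, (hmul 3 1).2,
        (hmul 1 3).2]
      simp [hξ0, i1]
    have nn : 0 ≤ ∑ j ∈ s, l j := Finset.sum_nonneg fun j _ => hl j
    refine ⟨?_, ?_, ?_⟩
    · have := integral_add (by simpa using iξ 1) (by simpa using iS 1)
      rw [this, hξ0, i1, add_zero]
    · rw [e2, mul_add]
      exact add_le_add (h2 i) i2
    · rw [e4]
      have hprod : (∫ ω, S ω ^ 2 ∂P) * ∫ ω, ξ i ω ^ 2 ∂P ≤ (a * ∑ j ∈ s, l j) * (a * l i) :=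
        mul_le_mul i2 (h2 i) (integral_nonneg fun ω => sq_nonneg _) (mul_nonneg ha nn)
      have h4i := h4 i
      have h1 : 0 ≤ a ^ 2 * l i ^ 2 := by positivity
      have h3 : 0 ≤ b * ((∑ j ∈ s, l j) * l i) := mul_nonneg hb (mul_nonneg nn (hl i))
      nlinarith

theorem integral_centred_sum_mul_centred_sum {ι κ : Type*} {s : Finset ι} {t : Finset κ}
    {Y : ι → Ω → ℝ} {Z : κ → Ω → ℝ}
    (h : ∀ i ∈ s, ∀ k ∈ t, HasGaussianLaw (fun ω => (Y i ω, Z k ω)) P)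
    (hY0 : ∀ i ∈ s, ∫ ω, Y i ω ∂P = 0) (hZ0 : ∀ k ∈ t, ∫ ω, Z k ω ∂P = 0) :
    ∫ ω, (∑ i ∈ s, (Y i ω ^ 2 - ∫ ω, Y i ω ^ 2 ∂P)) *
        (∑ k ∈ t, (Z k ω ^ 2 - ∫ ω, Z k ω ^ 2 ∂P)) ∂P =
      2 * ∑ i ∈ s, ∑ k ∈ t, (∫ ω, Y i ω * Z k ω ∂P) ^ 2 := by
  have key : ∀ i ∈ s, ∀ k ∈ t,
      Integrable (fun ω => (Y i ω ^ 2 - ∫ ω, Y i ω ^ 2 ∂P) * (Z k ω ^ 2 - ∫ ω, Z k ω ^ 2 ∂P)) P ∧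
      ∫ ω, (Y i ω ^ 2 - ∫ ω, Y i ω ^ 2 ∂P) * (Z k ω ^ 2 - ∫ ω, Z k ω ^ 2 ∂P) ∂P =
        2 * (∫ ω, Y i ω * Z k ω ∂P) ^ 2 := fun i hi k hk => by
    have hg := h i hi k hk
    have := hg.isProbabilityMeasure
    have iY2 := integrable_pow_of_gaussian hg.fst 2
    have iZ2 := integrable_pow_of_gaussian hg.snd 2
    have hL : ∀ {X : Ω → ℝ}, HasGaussianLaw X P → MemLp (fun ω => X ω ^ 2) 2 P := fun {X} hX => by
      refine (memLp_two_iff_integrable_sq (hX.aemeasurable.pow_const 2).aestronglyMeasurable).2 ?_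
      simpa only [← pow_mul] using integrable_pow_of_gaussian hX 4
    have iYZ : Integrable (fun ω => Y i ω ^ 2 * Z k ω ^ 2) P :=
      (hL hg.fst).integrable_mul (hL hg.snd)
    set a := ∫ ω, Y i ω ^ 2 ∂P with ha
    set b := ∫ ω, Z k ω ^ 2 ∂P with hb
    have e : (fun ω => (Y i ω ^ 2 - a) * (Z k ω ^ 2 - b)) = fun ω =>
        Y i ω ^ 2 * Z k ω ^ 2 - b * Y i ω ^ 2 - a * Z k ω ^ 2 + a * b := by
      ext ω; ring
    have i1 : Integrable (fun ω => Y i ω ^ 2 * Z k ω ^ 2 - b * Y i ω ^ 2) P :=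
      iYZ.sub (iY2.const_mul b)
    have i2 : Integrable (fun ω => Y i ω ^ 2 * Z k ω ^ 2 - b * Y i ω ^ 2 - a * Z k ω ^ 2) P :=
      i1.sub (iZ2.const_mul a)
    rw [e]
    refine ⟨i2.add (integrable_const _), ?_⟩
    rw [integral_add i2 (integrable_const _), integral_sub i1 (iZ2.const_mul a),
      integral_sub iYZ (iY2.const_mul b), integral_const_mul, integral_const_mul,
      integral_sq_mul_sq_of_gaussian hg (hY0 i hi) (hZ0 k hk), ← ha, ← hb]
    simp
    ring
  simp_rw [Finset.sum_mul_sum]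
  rw [integral_finsetSum _ fun i hi => integrable_finsetSum _ fun k hk => (key i hi k hk).1,
    Finset.mul_sum]
  refine Finset.sum_congr rfl fun i hi => ?_
  rw [integral_finsetSum _ fun k hk => (key i hi k hk).1, Finset.mul_sum]
  exact Finset.sum_congr rfl fun k hk => (key i hi k hk).2

/-- The constant in the fourth moment bound for centred Gaussian quadratic forms. -/
noncomputable def fourthConst : ℝ := 3 * (∫ x, (x ^ 2 - 1) ^ 2 ∂γ) ^ 2 + ∫ x, (x ^ 2 - 1) ^ 4 ∂γ

theorem fourthConst_nonneg : 0 ≤ fourthConst :=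
  add_nonneg (by positivity) (integral_nonneg fun x => by positivity)

theorem integral_centred_sum_pow_four_le_of_iIndepFun [IsProbabilityMeasure P] {ι : Type*}
    {G : ι → Ω → ℝ} (hG : ∀ i, HasGaussianLaw (G i) P) (h0 : ∀ i, ∫ ω, G i ω ∂P = 0)
    (hind : iIndepFun G P) (s : Finset ι) :
    ∫ ω, (∑ i ∈ s, (G i ω ^ 2 - ∫ ω, G i ω ^ 2 ∂P)) ^ 4 ∂P ≤
      fourthConst * (∑ i ∈ s, (∫ ω, G i ω ^ 2 ∂P) ^ 2) ^ 2 := by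
  refine (integral_sum_pow_le_of_iIndepFun
    (ξ := fun i ω => G i ω ^ 2 - ∫ ω, G i ω ^ 2 ∂P) (l := fun i => (∫ ω, G i ω ^ 2 ∂P) ^ 2)
    (a := ∫ x, (x ^ 2 - 1) ^ 2 ∂γ) (b := ∫ x, (x ^ 2 - 1) ^ 4 ∂γ) ?_ ?_ ?_ ?_ ?_ ?_ ?_ ?_ s).2.2
  · exact hind.comp (fun i x => x ^ 2 - ∫ ω, G i ω ^ 2 ∂P) fun i => by fun_prop
  · intro i k
    refine MemLp.sub ?_ (memLp_const _)
    rcases eq_or_ne k 0 with rfl | hk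
    · simpa using ((hG i).aemeasurable.pow_const 2).aestronglyMeasurable
    have h1 : Integrable (fun ω => ‖G i ω ^ 2‖ ^ k) P := by
      simpa [← pow_mul] using integrable_pow_of_gaussian (hG i) (2 * k)
    have := (integrable_norm_rpow_iff (p := (k : ENNReal))
      ((hG i).aemeasurable.pow_const 2).aestronglyMeasurable (by simpa using hk) (by simp)).1
      (by simpa using h1)
    exact this
  · intro i
    rw [integral_sub (integrable_pow_of_gaussian (hG i) 2) (integrable_const _)]
    simp
  · exact fun i => by positivity
  · exact integral_nonneg fun x => by positivity
  · exact integral_nonneg fun x => by positivity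
  · intro i
    rw [integral_sq_sub_pow_of_centred (hG i) (h0 i), mul_comm]
  · intro i
    rw [integral_sq_sub_pow_of_centred (hG i) (h0 i), mul_comm, ← pow_mul]

-- An orthogonal change of basis diagonalises the covariance matrix S. The new coordinates are
-- uncorrelated and jointly Gaussian, hence independent; the sum of squares is unchanged; and the
-- sum of the squared variances is tr S², which is the sum of all squared covariances.
open Matrix in
theorem integral_centred_sum_pow_four_le {ι : Type*} [Fintype ι] {Y : ι → Ω → ℝ}
    (hY : HasGaussianLaw (fun ω i => Y i ω) P) (h0 : ∀ i, ∫ ω, Y i ω ∂P = 0) :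
    ∫ ω, (∑ i, (Y i ω ^ 2 - ∫ ω, Y i ω ^ 2 ∂P)) ^ 4 ∂P ≤
      fourthConst * (∑ i, ∑ j, (∫ ω, Y i ω * Y j ω ∂P) ^ 2) ^ 2 := by
  classical
  have := hY.isProbabilityMeasure
  set S : Matrix ι ι ℝ := Matrix.of fun i j => ∫ ω, Y i ω * Y j ω ∂P with hSdef
  have hS : S.IsHermitian := by
    ext i j
    simp [hSdef, mul_comm]
  set U : Matrix ι ι ℝ := (hS.eigenvectorUnitary : Matrix ι ι ℝ) with hU
  have hUU : U * Uᵀ = 1 := by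
    have := Unitary.mul_star_self_of_mem hS.eigenvectorUnitary.2
    rwa [← hU, star_eq_conjTranspose, conjTranspose_eq_transpose_of_trivial] at this
  have hD : Uᵀ * S * U = diagonal hS.eigenvalues := by
    have := hS.conjStarAlgAut_star_eigenvectorUnitary
    rw [Unitary.conjStarAlgAut_star_apply, ← hU, star_eq_conjTranspose,
      conjTranspose_eq_transpose_of_trivial] at this
    simpa using this
  have hYi : ∀ i, HasGaussianLaw (Y i) P := fun i => hY.eval i
  have iYY : ∀ i j, Integrable (fun ω => Y i ω * Y j ω) P := fun i j =>
    (hYi i).memLp_two.integrable_mul (hYi j).memLp_two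
  set G : ι → Ω → ℝ := fun k ω => (Uᵀ *ᵥ fun i => Y i ω) k with hGdef
  have hGlaw : HasGaussianLaw (fun ω k => G k ω) P :=
    hY.map_fun (LinearMap.toContinuousLinearMap (Matrix.mulVecLin Uᵀ))
  have hGk : ∀ k, HasGaussianLaw (G k) P := fun k => hGlaw.eval k
  have hGe : ∀ k ω, G k ω = ∑ i, U i k * Y i ω := fun k ω => by
    simp [hGdef, mulVec, dotProduct]
  have hG0 : ∀ k, ∫ ω, G k ω ∂P = 0 := fun k => by
    simp_rw [hGe]
    rw [integral_finsetSum _ fun i _ => (hYi i).integrable.const_mul _]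
    simp [integral_const_mul, h0]
  have hGG : ∀ k l, ∫ ω, G k ω * G l ω ∂P = (Uᵀ * S * U) k l := fun k l => by
    simp_rw [hGe, Finset.sum_mul_sum]
    rw [integral_finsetSum _ fun i _ => integrable_finsetSum _ fun j _ =>
      ((iYY i j).const_mul (U i k * U j l)).congr (ae_of_all _ fun ω => by ring)]
    simp only [mul_apply, transpose_apply, Finset.sum_mul, hSdef, of_apply]
    rw [Finset.sum_comm]
    refine Finset.sum_congr rfl fun i _ => ?_
    rw [integral_finsetSum _ fun j _ =>
      ((iYY i j).const_mul (U i k * U j l)).congr (ae_of_all _ fun ω => by ring)]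
    refine Finset.sum_congr rfl fun j _ => ?_
    rw [show U i k * (∫ ω, Y i ω * Y j ω ∂P) * U j l =
      U i k * U j l * ∫ ω, Y i ω * Y j ω ∂P by ring, ← integral_const_mul]
    congr 1 with ω
    ring
  have hind : iIndepFun G P := by
    refine hGlaw.iIndepFun_of_covariance_eq_zero fun k l hkl => ?_
    rw [covariance_eq_sub (hGk k).memLp_two (hGk l).memLp_two, hG0, zero_mul, sub_zero]
    simp only [Pi.mul_apply]
    rw [hGG, hD, diagonal_apply_ne _ hkl]
  have hsq : ∀ ω, ∑ k, G k ω ^ 2 = ∑ i, Y i ω ^ 2 := fun ω => by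
    have e1 : ∑ k, G k ω ^ 2 = (Uᵀ *ᵥ fun i => Y i ω) ⬝ᵥ (Uᵀ *ᵥ fun i => Y i ω) := by
      simp [dotProduct, hGdef, sq]
    have e2 : ∑ i, Y i ω ^ 2 = (fun i => Y i ω) ⬝ᵥ (fun i => Y i ω) := by
      simp [dotProduct, sq]
    rw [e1, e2, dotProduct_mulVec, vecMul_transpose, mulVec_mulVec, hUU, one_mulVec]
  have iG2 := fun k => integrable_pow_of_gaussian (hGk k) 2
  have iY2 := fun i => integrable_pow_of_gaussian (hYi i) 2
  have hcent : ∀ ω, ∑ k, (G k ω ^ 2 - ∫ ω, G k ω ^ 2 ∂P) =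
      ∑ i, (Y i ω ^ 2 - ∫ ω, Y i ω ^ 2 ∂P) := fun ω => by
    rw [Finset.sum_sub_distrib, Finset.sum_sub_distrib, hsq,
      ← integral_finsetSum _ fun k _ => iG2 k, ← integral_finsetSum _ fun i _ => iY2 i]
    simp_rw [hsq]
  have htr : ∑ k, (∫ ω, G k ω ^ 2 ∂P) ^ 2 = ∑ i, ∑ j, (∫ ω, Y i ω * Y j ω ∂P) ^ 2 := by
    have e1 : ∑ k, (∫ ω, G k ω ^ 2 ∂P) ^ 2 =
        ((Uᵀ * S * U) * (Uᵀ * S * U)).trace := by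
      have : ∀ k, ∫ ω, G k ω ^ 2 ∂P = hS.eigenvalues k := fun k => by
        simp_rw [sq]
        rw [hGG, hD, diagonal_apply_eq]
      simp_rw [this]
      rw [hD, diagonal_mul_diagonal, trace_diagonal]
      simp [sq]
    have e2 : (Uᵀ * S * U) * (Uᵀ * S * U) = Uᵀ * (S * S * U) := by
      calc (Uᵀ * S * U) * (Uᵀ * S * U) = Uᵀ * S * (U * Uᵀ) * S * U := by
            simp only [Matrix.mul_assoc]
        _ = _ := by rw [hUU]; simp only [Matrix.mul_one, Matrix.mul_assoc]
    rw [e1, e2, trace_mul_comm, Matrix.mul_assoc, hUU, Matrix.mul_one]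
    simp only [trace, diag_apply, mul_apply]
    refine Finset.sum_congr rfl fun i _ => Finset.sum_congr rfl fun j _ => ?_
    have : S j i = S i j := by simpa using congr_fun (congr_fun hS i) j
    rw [this, sq]
    rfl
  have := integral_centred_sum_pow_four_le_of_iIndepFun hGk hG0 hind Finset.univ
  simp_rw [hcent] at this
  rwa [htr] at this

/-! ### Linearising the logarithm of a concentrated variable. -/

theorem abs_log_sub_le {x : ℝ} (hx : 1 / 2 ≤ x) : |Real.log x - (x - 1)| ≤ 2 * (x - 1) ^ 2 := by
  have hx0 : 0 < x := by linarith
  have h1 := Real.log_le_sub_one_of_pos hx0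
  have h2 := Real.one_sub_inv_le_log_of_pos hx0
  rw [abs_of_nonpos (by linarith)]
  have h3 : x⁻¹ - 1 + (x - 1) = (x - 1) ^ 2 * x⁻¹ := by field_simp; ring
  have h4 : x⁻¹ ≤ 2 := by
    rw [inv_le_comm₀ hx0 (by norm_num)]; linarith
  nlinarith [sq_nonneg (x - 1)]

/-- The part of `|log x|` that comes from small arguments. -/
noncomputable def lowLog (x : ℝ) : ℝ := if x < 1 / 2 then |Real.log x| else 0

theorem measurable_lowLog : Measurable lowLog :=
  Measurable.ite measurableSet_Iio (by fun_prop) measurable_const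

theorem abs_log_sub_le_lowLog {x : ℝ} (hx : 0 < x) :
    |Real.log x - (x - 1)| ≤ 5 * (x - 1) ^ 2 + lowLog x := by
  unfold lowLog
  split_ifs with h
  · refine (abs_sub _ _).trans ?_
    have : |x - 1| ≤ 5 * (x - 1) ^ 2 := by
      rw [abs_of_nonpos (by linarith)]
      nlinarith
    linarith
  · have := abs_log_sub_le (not_lt.1 h)
    nlinarith [sq_nonneg (x - 1)]

/-- Where it is nonzero, `lowLog` is at least 1/2, so a bound on its second moment also controls its
mean at the same rate. -/
theorem lowLog_le {x : ℝ} (hx : 0 < x) : lowLog x ≤ 2 * lowLog x ^ 2 := by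
  unfold lowLog
  split_ifs with h
  · have h1 : Real.log x ≤ -(1 / 2) := by
      have := Real.log_le_sub_one_of_pos hx
      linarith
    rw [abs_of_nonpos (by linarith)]
    nlinarith
  · simp

/-- This is log y ≤ 32 y^{1/32} at y = 1/x, raised to the eighth power. -/
theorem lowLog_pow_le {x : ℝ} (hx : 0 < x) : lowLog x ^ 8 ≤ 32 ^ 8 * x ^ (-(1 / 4) : ℝ) := by
  unfold lowLog
  split_ifs with h
  · have h1 := Real.log_le_rpow_div (inv_nonneg.2 hx.le) (show (0 : ℝ) < 1 / 32 by norm_num)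
    rw [Real.log_inv] at h1
    have h2 : Real.log x ≤ 0 := Real.log_nonpos hx.le (by linarith)
    rw [abs_of_nonpos h2]
    calc (-Real.log x) ^ 8 ≤ (x⁻¹ ^ (1 / 32 : ℝ) / (1 / 32)) ^ 8 :=
          pow_le_pow_left₀ (by linarith) h1 8
      _ = 32 ^ 8 * (x⁻¹ ^ (1 / 32 : ℝ)) ^ 8 := by ring
      _ = _ := by
        rw [← Real.rpow_natCast (x⁻¹ ^ _), ← Real.rpow_mul (inv_nonneg.2 hx.le),
          Real.inv_rpow hx.le, ← Real.rpow_neg hx.le]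
        norm_num
  · rw [zero_pow (by norm_num)]
    positivity

/-- Truncation at level `s`. Below it, 1 ≤ 16 (x - 1)⁴ on x < 1/2 brings in the small fourth moment;
above it, `lowLog x ^ 2` is at most `lowLog x ^ 8 / s ^ 3`, which the negative moment controls. -/
theorem lowLog_sq_le {x s : ℝ} (hx : 0 < x) (hs : 0 < s) :
    lowLog x ^ 2 ≤ 32 ^ 8 * (s ^ 3)⁻¹ * x ^ (-(1 / 4) : ℝ) + 16 * s * (x - 1) ^ 4 := by
  have h8 := lowLog_pow_le hx
  have hxp : 0 < x ^ (-(1 / 4) : ℝ) := Real.rpow_pos_of_pos hx _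
  by_cases hlt : x < 1 / 2
  · have hw : 1 ≤ 16 * (x - 1) ^ 4 := by
      have h1 : 1 / 4 ≤ (x - 1) ^ 2 := by nlinarith
      nlinarith
    rcases le_total (lowLog x ^ 2) s with h | h
    · have : 0 ≤ 32 ^ 8 * (s ^ 3)⁻¹ * x ^ (-(1 / 4) : ℝ) := by positivity
      nlinarith
    · have h1 : s ^ 3 * lowLog x ^ 2 ≤ lowLog x ^ 8 := by
        calc s ^ 3 * lowLog x ^ 2 ≤ (lowLog x ^ 2) ^ 3 * lowLog x ^ 2 := by gcongr
          _ = _ := by ring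
      have h2 : lowLog x ^ 2 ≤ (s ^ 3)⁻¹ * (32 ^ 8 * x ^ (-(1 / 4) : ℝ)) := by
        rw [inv_mul_eq_div, le_div_iff₀ (by positivity)]
        linarith
      have h3 : 0 ≤ 16 * s * (x - 1) ^ 4 := by positivity
      linarith
  · rw [lowLog, if_neg hlt, zero_pow (by norm_num)]
    positivity

/-- `X` is a positive random variable of mean one whose moments are those of an average of about
`n` nearly independent terms, with a mild control of its smallness. -/
structure IsConcentrated (P : Measure Ω) (K n : ℝ) (X : Ω → ℝ) : Prop where
  pos : ∀ᵐ ω ∂P, 0 < X ω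
  memLp : MemLp (fun ω => X ω - 1) 4 P
  mean : ∫ ω, (X ω - 1) ∂P = 0
  sq_le : ∫ ω, (X ω - 1) ^ 2 ∂P ≤ K * n⁻¹
  pow_four_le : ∫ ω, (X ω - 1) ^ 4 ∂P ≤ K * (n ^ 2)⁻¹
  integrable_rpow : Integrable (fun ω => X ω ^ (-(1 / 4) : ℝ)) P
  rpow_le : ∫ ω, X ω ^ (-(1 / 4) : ℝ) ∂P ≤ K * n ^ (1 / 4 : ℝ)

namespace IsConcentrated

variable {K n : ℝ} {X X' : Ω → ℝ}

theorem integrable_pow_four (h : IsConcentrated P K n X) :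
    Integrable (fun ω => (X ω - 1) ^ 4) P :=
  integrable_pow_of_memLp (by norm_num) (by exact_mod_cast h.memLp)

theorem aemeasurable (h : IsConcentrated P K n X) : AEMeasurable X P := by
  have := h.memLp.1.aemeasurable.add_const 1
  simpa using this

theorem const_nonneg (h : IsConcentrated P K n X) (hn : 1 ≤ n) : 0 ≤ K := by
  have h1 := (integral_nonneg fun ω => sq_nonneg (X ω - 1)).trans h.sq_le
  exact nonneg_of_mul_nonneg_left h1 (by positivity)

theorem lowLog_sq (h : IsConcentrated P K n X) (hn : 1 ≤ n) :
    Integrable (fun ω => lowLog (X ω) ^ 2) P ∧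
      ∫ ω, lowLog (X ω) ^ 2 ∂P ≤ (32 ^ 8 + 16) * K * n ^ (-(5 / 4) : ℝ) := by
  have hn0 : 0 < n := by linarith
  -- The truncation level is `√n`: it gives s⁻³ n^{1/4} = n^{-5/4} and s n⁻² = n^{-3/2}, both
  -- smaller than 1/n.
  have hs : 0 < √n := Real.sqrt_pos.2 hn0
  have hK := h.const_nonneg hn
  have hle : ∀ᵐ ω ∂P, lowLog (X ω) ^ 2 ≤
      32 ^ 8 * (√n ^ 3)⁻¹ * X ω ^ (-(1 / 4) : ℝ) + 16 * √n * (X ω - 1) ^ 4 := by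
    filter_upwards [h.pos] with ω hω
    exact lowLog_sq_le hω hs
  have i1 := h.integrable_rpow.const_mul (32 ^ 8 * (√n ^ 3)⁻¹)
  have i2 := h.integrable_pow_four.const_mul (16 * √n)
  have hint : Integrable (fun ω => lowLog (X ω) ^ 2) P := by
    refine (i1.add i2).mono'
      ((measurable_lowLog.comp_aemeasurable h.aemeasurable).pow_const 2).aestronglyMeasurable ?_
    filter_upwards [hle] with ω hω
    rw [Real.norm_of_nonneg (sq_nonneg _)]
    exact hω
  refine ⟨hint, (integral_mono_ae hint (i1.add i2) hle).trans ?_⟩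
  simp only [Pi.add_apply]
  rw [integral_add i1 i2, integral_const_mul, integral_const_mul]
  have e1 : (√n ^ 3)⁻¹ * n ^ (1 / 4 : ℝ) = n ^ (-(5 / 4) : ℝ) := by
    rw [Real.sqrt_eq_rpow, ← Real.rpow_natCast, ← Real.rpow_mul hn0.le, ← Real.rpow_neg hn0.le,
      ← Real.rpow_add hn0]
    norm_num
  have e2 : √n * (n ^ 2)⁻¹ ≤ n ^ (-(5 / 4) : ℝ) := by
    rw [Real.sqrt_eq_rpow, ← Real.rpow_natCast n 2, ← Real.rpow_neg hn0.le, ← Real.rpow_add hn0]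
    exact Real.rpow_le_rpow_of_exponent_le hn (by norm_num)
  calc _ ≤ 32 ^ 8 * (√n ^ 3)⁻¹ * (K * n ^ (1 / 4 : ℝ)) + 16 * √n * (K * (n ^ 2)⁻¹) := by
        gcongr
        · exact h.rpow_le
        · exact h.pow_four_le
    _ = 32 ^ 8 * K * ((√n ^ 3)⁻¹ * n ^ (1 / 4 : ℝ)) + 16 * K * (√n * (n ^ 2)⁻¹) := by ring
    _ ≤ 32 ^ 8 * K * n ^ (-(5 / 4) : ℝ) + 16 * K * n ^ (-(5 / 4) : ℝ) := by rw [e1]; gcongr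
    _ = _ := by ring

theorem memLp_log_sub (h : IsConcentrated P K n X) (hn : 1 ≤ n) :
    MemLp (fun ω => Real.log (X ω) - (X ω - 1)) 2 P ∧
      ∫ ω, (Real.log (X ω) - (X ω - 1)) ^ 2 ∂P ≤ (2 * 32 ^ 8 + 82) * K * n ^ (-(5 / 4) : ℝ) := by
  obtain ⟨iR, hR⟩ := h.lowLog_sq hn
  have hn0 : 0 < n := by linarith
  have hK := h.const_nonneg hn
  have hle : ∀ᵐ ω ∂P, (Real.log (X ω) - (X ω - 1)) ^ 2 ≤
      50 * (X ω - 1) ^ 4 + 2 * lowLog (X ω) ^ 2 := by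
    filter_upwards [h.pos] with ω hω
    have h1 := abs_log_sub_le_lowLog hω
    calc (Real.log (X ω) - (X ω - 1)) ^ 2 = |Real.log (X ω) - (X ω - 1)| ^ 2 := (sq_abs _).symm
      _ ≤ (5 * (X ω - 1) ^ 2 + lowLog (X ω)) ^ 2 := by gcongr
      _ ≤ _ := by nlinarith [sq_nonneg (5 * (X ω - 1) ^ 2 - lowLog (X ω))]
  have hm : AEStronglyMeasurable (fun ω => Real.log (X ω) - (X ω - 1)) P :=
    ((Real.measurable_log.comp_aemeasurable h.aemeasurable).sub
      (h.aemeasurable.sub_const 1)).aestronglyMeasurable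
  have i1 := h.integrable_pow_four.const_mul 50
  have i2 := iR.const_mul 2
  have hint : Integrable (fun ω => (Real.log (X ω) - (X ω - 1)) ^ 2) P := by
    refine (i1.add i2).mono' (hm.pow 2) ?_
    filter_upwards [hle] with ω hω
    rw [Real.norm_of_nonneg (sq_nonneg _)]
    exact hω
  refine ⟨(memLp_two_iff_integrable_sq hm).2 hint, (integral_mono_ae hint (i1.add i2) hle).trans ?_⟩
  simp only [Pi.add_apply]
  rw [integral_add i1 i2, integral_const_mul, integral_const_mul]
  have e2 : (n ^ 2)⁻¹ ≤ n ^ (-(5 / 4) : ℝ) := by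
    rw [← Real.rpow_natCast n 2, ← Real.rpow_neg hn0.le]
    exact Real.rpow_le_rpow_of_exponent_le hn (by norm_num)
  calc _ ≤ 50 * (K * (n ^ 2)⁻¹) + 2 * ((32 ^ 8 + 16) * K * n ^ (-(5 / 4) : ℝ)) := by
        gcongr
        exact h.pow_four_le
    _ ≤ 50 * (K * n ^ (-(5 / 4) : ℝ)) + 2 * ((32 ^ 8 + 16) * K * n ^ (-(5 / 4) : ℝ)) := by gcongr
    _ = _ := by ring

variable [IsProbabilityMeasure P]

theorem memLp_two (h : IsConcentrated P K n X) : MemLp (fun ω => X ω - 1) 2 P :=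
  h.memLp.mono_exponent (by norm_num)

theorem memLp_log (h : IsConcentrated P K n X) (hn : 1 ≤ n) :
    MemLp (fun ω => Real.log (X ω)) 2 P := by
  refine ((h.memLp_log_sub hn).1.add h.memLp_two).ae_eq (ae_of_all _ fun ω => ?_)
  simp

/-- The linear part has mean zero, so the mean of the logarithm is of second order. -/
theorem abs_integral_log_le (h : IsConcentrated P K n X) (hn : 1 ≤ n) :
    |∫ ω, Real.log (X ω) ∂P| ≤ (2 * 32 ^ 8 + 82) * K * n⁻¹ := by
  obtain ⟨iR, hR⟩ := h.lowLog_sq hn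
  have hn0 : 0 < n := by linarith
  have hK := h.const_nonneg hn
  have iD : Integrable (fun ω => Real.log (X ω) - (X ω - 1)) P :=
    (h.memLp_log_sub hn).1.integrable (by norm_num)
  have iW : Integrable (fun ω => X ω - 1) P := h.memLp_two.integrable (by norm_num)
  have e : ∫ ω, Real.log (X ω) ∂P = ∫ ω, (Real.log (X ω) - (X ω - 1)) ∂P := by
    rw [integral_sub ((h.memLp_log hn).integrable (by norm_num)) iW, h.mean, sub_zero]
  have hle : ∀ᵐ ω ∂P, |Real.log (X ω) - (X ω - 1)| ≤
      5 * (X ω - 1) ^ 2 + 2 * lowLog (X ω) ^ 2 := by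
    filter_upwards [h.pos] with ω hω
    linarith [abs_log_sub_le_lowLog hω, lowLog_le hω]
  have i1 := h.memLp_two.integrable_sq.const_mul 5
  have i2 := iR.const_mul 2
  rw [e]
  refine (abs_integral_le_integral_abs).trans
    ((integral_mono_ae iD.abs (i1.add i2) hle).trans ?_)
  simp only [Pi.add_apply]
  rw [integral_add i1 i2, integral_const_mul, integral_const_mul]
  have e2 : n ^ (-(5 / 4) : ℝ) ≤ n⁻¹ := by
    rw [← Real.rpow_neg_one]
    exact Real.rpow_le_rpow_of_exponent_le hn (by norm_num)
  calc _ ≤ 5 * (K * n⁻¹) + 2 * ((32 ^ 8 + 16) * K * n ^ (-(5 / 4) : ℝ)) := by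
        gcongr
        exact h.sq_le
    _ ≤ 5 * (K * n⁻¹) + 2 * ((32 ^ 8 + 16) * K * n⁻¹) := by gcongr
    _ ≤ _ := by
      have : 0 ≤ K * n⁻¹ := by positivity
      linarith

theorem abs_integral_log_mul_log_sub_le (h : IsConcentrated P K n X) (h' : IsConcentrated P K n X')
    (hn : 1 ≤ n) :
    |∫ ω, Real.log (X ω) * Real.log (X' ω) ∂P - ∫ ω, (X ω - 1) * (X' ω - 1) ∂P| ≤
      (2 * (2 * 32 ^ 8 + 82) + 1) * K * n ^ (-(9 / 8) : ℝ) := by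
  have hn0 : 0 < n := by linarith
  have hK := h.const_nonneg hn
  obtain ⟨mD, hD⟩ := h.memLp_log_sub hn
  obtain ⟨mD', hD'⟩ := h'.memLp_log_sub hn
  set D := fun ω => Real.log (X ω) - (X ω - 1) with hDdef
  set D' := fun ω => Real.log (X' ω) - (X' ω - 1) with hDdef'
  -- Weight in Young's inequality, chosen to balance e · n⁻¹ against e⁻¹ · n^{-5/4}; both become
  -- n^{-9/8}.
  set e : ℝ := n ^ (-(1 / 8) : ℝ) with he
  have he0 : 0 < e := Real.rpow_pos_of_pos hn0 _
  have hle : ∀ ω, |Real.log (X ω) * Real.log (X' ω) - (X ω - 1) * (X' ω - 1)| ≤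
      (1 / 2) * (e * (X ω - 1) ^ 2 + e * (X' ω - 1) ^ 2 + (e⁻¹ + 1) * D ω ^ 2 +
        (e⁻¹ + 1) * D' ω ^ 2) := fun ω => by
    have e1 : Real.log (X ω) * Real.log (X' ω) - (X ω - 1) * (X' ω - 1) =
        (X ω - 1) * D' ω + (X' ω - 1) * D ω + D ω * D' ω := by
      simp only [hDdef, hDdef']; ring
    have young : ∀ x y : ℝ, |x * y| ≤ (1 / 2) * (e * x ^ 2 + e⁻¹ * y ^ 2) := fun x y => by
      have h1 : 0 ≤ e⁻¹ * (e * |x| - |y|) ^ 2 := by positivity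
      have h2 : e⁻¹ * (e * |x| - |y|) ^ 2 = e * x ^ 2 + e⁻¹ * y ^ 2 - 2 * |x * y| := by
        rw [abs_mul, ← sq_abs x, ← sq_abs y]; field_simp; ring
      linarith
    have h3 : |D ω * D' ω| ≤ (1 / 2) * (D ω ^ 2 + D' ω ^ 2) := by
      rw [abs_mul, ← sq_abs (D ω), ← sq_abs (D' ω)]
      nlinarith [sq_nonneg (|D ω| - |D' ω|)]
    rw [e1]
    refine (abs_add_three _ _ _).trans ?_
    linarith [young (X ω - 1) (D' ω), young (X' ω - 1) (D ω)]
  have iW := h.memLp_two.integrable_sq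
  have iW' := h'.memLp_two.integrable_sq
  have iD := mD.integrable_sq
  have iD' := mD'.integrable_sq
  have iL : Integrable (fun ω => Real.log (X ω) * Real.log (X' ω)) P :=
    (h.memLp_log hn).integrable_mul (h'.memLp_log hn)
  have iWW : Integrable (fun ω => (X ω - 1) * (X' ω - 1)) P :=
    h.memLp_two.integrable_mul h'.memLp_two
  have j1 : Integrable (fun ω => e * (X ω - 1) ^ 2 + e * (X' ω - 1) ^ 2) P :=
    (iW.const_mul e).add (iW'.const_mul e)
  have j2 : Integrable (fun ω => e * (X ω - 1) ^ 2 + e * (X' ω - 1) ^ 2 + (e⁻¹ + 1) * D ω ^ 2) P :=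
    j1.add (iD.const_mul _)
  have j3 : Integrable (fun ω => e * (X ω - 1) ^ 2 + e * (X' ω - 1) ^ 2 + (e⁻¹ + 1) * D ω ^ 2 +
      (e⁻¹ + 1) * D' ω ^ 2) P := j2.add (iD'.const_mul _)
  rw [← integral_sub iL iWW]
  refine abs_integral_le_integral_abs.trans
    ((integral_mono (iL.sub iWW).abs (j3.const_mul (1 / 2)) hle).trans ?_)
  rw [integral_const_mul, integral_add j2 (iD'.const_mul _), integral_add j1 (iD.const_mul _),
    integral_add (iW.const_mul e) (iW'.const_mul e), integral_const_mul, integral_const_mul,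
    integral_const_mul, integral_const_mul]
  have q1 : e * n⁻¹ = n ^ (-(9 / 8) : ℝ) := by
    rw [he, ← Real.rpow_neg_one, ← Real.rpow_add hn0]; norm_num
  have q2 : e⁻¹ * n ^ (-(5 / 4) : ℝ) = n ^ (-(9 / 8) : ℝ) := by
    rw [he, ← Real.rpow_neg hn0.le, ← Real.rpow_add hn0]; norm_num
  have q3 : n ^ (-(5 / 4) : ℝ) ≤ n ^ (-(9 / 8) : ℝ) :=
    Real.rpow_le_rpow_of_exponent_le hn (by norm_num)
  set M : ℝ := 2 * 32 ^ 8 + 82 with hM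
  have hM0 : 0 ≤ M := by norm_num [hM]
  calc _ ≤ 1 / 2 * (e * (K * n⁻¹) + e * (K * n⁻¹) + (e⁻¹ + 1) * (M * K * n ^ (-(5 / 4) : ℝ)) +
        (e⁻¹ + 1) * (M * K * n ^ (-(5 / 4) : ℝ))) := by
        gcongr
        · exact h.sq_le
        · exact h'.sq_le
    _ = K * (e * n⁻¹) + M * K * (e⁻¹ * n ^ (-(5 / 4) : ℝ)) + M * K * n ^ (-(5 / 4) : ℝ) := by ring
    _ ≤ K * n ^ (-(9 / 8) : ℝ) + M * K * n ^ (-(9 / 8) : ℝ) + M * K * n ^ (-(9 / 8) : ℝ) := by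
        rw [q1, q2]; gcongr
    _ = _ := by ring

theorem abs_integral_mul_le (h : IsConcentrated P K n X) (h' : IsConcentrated P K n X') :
    |∫ ω, (X ω - 1) * (X' ω - 1) ∂P| ≤ K * n⁻¹ := by
  have iW := h.memLp_two.integrable_sq
  have iW' := h'.memLp_two.integrable_sq
  have hle : ∀ ω, |(X ω - 1) * (X' ω - 1)| ≤ (1 / 2) * ((X ω - 1) ^ 2 + (X' ω - 1) ^ 2) :=
    fun ω => by
      rw [abs_mul, ← sq_abs (X ω - 1), ← sq_abs (X' ω - 1)]
      nlinarith [sq_nonneg (|X ω - 1| - |X' ω - 1|)]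
  have iWW : Integrable (fun ω => (X ω - 1) * (X' ω - 1)) P :=
    h.memLp_two.integrable_mul h'.memLp_two
  refine abs_integral_le_integral_abs.trans
    ((integral_mono iWW.abs ((iW.add iW').const_mul (1 / 2)) hle).trans ?_)
  simp only [Pi.add_apply]
  rw [integral_const_mul, integral_add iW iW']
  linarith [h.sq_le, h'.sq_le]

end IsConcentrated

/-! ### Concentration of means of squares. -/

/-- A bound for the moments of the mean of squares of a centred Gaussian sequence, if `B` bounds
the row sums of the squared correlations. -/
noncomputable def concentrationConst (B : ℝ) : ℝ :=
  2 * B + fourthConst * B ^ 2 + ∫ x, |x| ^ (-(1 / 2) : ℝ) ∂γ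

theorem mean_sq_div_sub_one {Y : ℕ → Ω → ℝ} {v : ℝ} {n : ℕ} (hn : 1 ≤ n) (hv : 0 < v)
    (hvar : ∀ j ∈ Finset.Icc 1 n, ∫ ω, Y j ω ^ 2 ∂P = v) (ω : Ω) :
    (1 / (n : ℝ) * ∑ j ∈ Finset.Icc 1 n, Y j ω ^ 2) / v - 1 =
      ((n : ℝ) * v)⁻¹ * ∑ j ∈ Finset.Icc 1 n, (Y j ω ^ 2 - ∫ ω, Y j ω ^ 2 ∂P) := by
  have hn0 : (0 : ℝ) < n := by exact_mod_cast hn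
  rw [Finset.sum_sub_distrib, Finset.sum_congr rfl hvar]
  simp only [Finset.sum_const, Nat.card_Icc, add_tsub_cancel_right, nsmul_eq_mul]
  field_simp

theorem isConcentrated_mean_sq {Y : ℕ → Ω → ℝ} (hY : IsGaussianProcess Y P)
    (h0 : ∀ j, ∫ ω, Y j ω ∂P = 0) {v : ℝ} (hv : 0 < v) {n : ℕ} (hn : 1 ≤ n)
    (hvar : ∀ j ∈ Finset.Icc 1 n, ∫ ω, Y j ω ^ 2 ∂P = v) {B : ℝ} (hB : 0 ≤ B)
    (hcov : ∑ j ∈ Finset.Icc 1 n, ∑ k ∈ Finset.Icc 1 n, (∫ ω, Y j ω * Y k ω ∂P) ^ 2 ≤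
      B * v ^ 2 * n) :
    IsConcentrated P (concentrationConst B) n
      (fun ω => (1 / (n : ℝ) * ∑ j ∈ Finset.Icc 1 n, Y j ω ^ 2) / v) := by
  have := hY.isProbabilityMeasure
  have hn0 : (0 : ℝ) < n := by exact_mod_cast hn
  have hg : ∀ j, HasGaussianLaw (Y j) P := fun j => hY.hasGaussianLaw_eval j
  have h1mem : 1 ∈ Finset.Icc 1 n := Finset.mem_Icc.2 ⟨le_rfl, hn⟩
  have hF := fourthConst_nonneg
  have hI : 0 ≤ ∫ x, |x| ^ (-(1 / 2) : ℝ) ∂γ := integral_nonneg fun x => by positivity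
  have hsub := mean_sq_div_sub_one hn hv hvar
  have hQ2 : ∫ ω, (∑ j ∈ Finset.Icc 1 n, (Y j ω ^ 2 - ∫ ω, Y j ω ^ 2 ∂P)) ^ 2 ∂P ≤
      2 * (B * v ^ 2 * n) := by
    simp_rw [sq (∑ j ∈ Finset.Icc 1 n, (Y j _ ^ 2 - _))]
    rw [integral_centred_sum_mul_centred_sum (fun i _ k _ => hY.hasGaussianLaw_prodMk)
      (fun i _ => h0 i) (fun k _ => h0 k)]
    gcongr
  have hQ4 : ∫ ω, (∑ j ∈ Finset.Icc 1 n, (Y j ω ^ 2 - ∫ ω, Y j ω ^ 2 ∂P)) ^ 4 ∂P ≤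
      fourthConst * (B * v ^ 2 * n) ^ 2 := by
    have h := integral_centred_sum_pow_four_le (Y := fun j : Finset.Icc 1 n => Y j)
      (hY.hasGaussianLaw (Finset.Icc 1 n)) (fun j => h0 j)
    rw [Finset.sum_coe_sort (Finset.Icc 1 n)
      (fun j => ∑ k : Finset.Icc 1 n, (∫ ω, Y j ω * Y k ω ∂P) ^ 2)] at h
    have e1 : ∀ j, ∑ k : Finset.Icc 1 n, (∫ ω, Y j ω * Y k ω ∂P) ^ 2 =
        ∑ k ∈ Finset.Icc 1 n, (∫ ω, Y j ω * Y k ω ∂P) ^ 2 := fun j =>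
      Finset.sum_coe_sort (Finset.Icc 1 n) (fun k => (∫ ω, Y j ω * Y k ω ∂P) ^ 2)
    have e2 : ∀ ω, ∑ j : Finset.Icc 1 n, (Y j ω ^ 2 - ∫ ω, Y j ω ^ 2 ∂P) =
        ∑ j ∈ Finset.Icc 1 n, (Y j ω ^ 2 - ∫ ω, Y j ω ^ 2 ∂P) := fun ω =>
      Finset.sum_coe_sort (Finset.Icc 1 n) (fun j => Y j ω ^ 2 - ∫ ω, Y j ω ^ 2 ∂P)
    simp_rw [e1, e2] at h
    refine h.trans ?_
    gcongr
  have hmem : ∀ j, MemLp (fun ω => Y j ω ^ 2) 4 P := fun j => by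
    have h1 : Integrable (fun ω => ‖Y j ω ^ 2‖ ^ 4) P := by
      simpa [← pow_mul] using integrable_pow_of_gaussian (hg j) 8
    exact (integrable_norm_rpow_iff ((hg j).aemeasurable.pow_const 2).aestronglyMeasurable
      (by norm_num) (by norm_num)).1 (by simpa using h1)
  have hne := ae_ne_zero_of_centred (hg 1) (h0 1) ((hvar 1 h1mem).symm ▸ hv)
  -- A single summand gives positivity and the negative moment: the power -1/4 of its square is `|Y
  -- 1| ^ (-1/2)`, integrable since -1/2 > -1. The price is the factor n^{1/4}.
  have hlow : ∀ ω, Y 1 ω ^ 2 / (n * v) ≤ (1 / (n : ℝ) * ∑ j ∈ Finset.Icc 1 n, Y j ω ^ 2) / v :=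
    fun ω => by
      rw [← div_div, div_eq_inv_mul (Y 1 ω ^ 2), one_div]
      gcongr
      exact Finset.single_le_sum (f := fun j => Y j ω ^ 2) (fun j _ => sq_nonneg _) h1mem
  have hrp : ∀ᵐ ω ∂P, ((1 / (n : ℝ) * ∑ j ∈ Finset.Icc 1 n, Y j ω ^ 2) / v) ^ (-(1 / 4) : ℝ) ≤
      (n * v) ^ (1 / 4 : ℝ) * |Y 1 ω| ^ (-(1 / 2) : ℝ) := by
    filter_upwards [hne] with ω hω
    have h2 : 0 < Y 1 ω ^ 2 / (n * v) := by positivity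
    refine (Real.rpow_le_rpow_of_nonpos h2 (hlow ω) (by norm_num)).trans_eq ?_
    rw [Real.div_rpow (by positivity) (by positivity), Real.rpow_neg (by positivity) (1 / 4),
      Real.rpow_neg (by positivity) (1 / 4), div_inv_eq_mul, mul_comm, ← sq_abs,
      ← Real.rpow_natCast, ← Real.rpow_mul (abs_nonneg _), ← Real.rpow_neg (abs_nonneg _)]
    norm_num
  have iabs := (integrable_abs_rpow_of_centred (hg 1) (h0 1) (s := -(1 / 2))
    (by norm_num)).const_mul ((n * v) ^ (1 / 4 : ℝ))
  have irp : Integrable (fun ω =>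
      ((1 / (n : ℝ) * ∑ j ∈ Finset.Icc 1 n, Y j ω ^ 2) / v) ^ (-(1 / 4) : ℝ)) P := by
    refine iabs.mono' ?_ ?_
    · refine AEMeasurable.aestronglyMeasurable ?_
      refine (AEMeasurable.div_const (AEMeasurable.const_mul ?_ _) v).pow_const _
      exact Finset.aemeasurable_fun_sum _ fun j _ => (hg j).aemeasurable.pow_const 2
    · filter_upwards [hrp] with ω hω
      rwa [Real.norm_of_nonneg]
      have : 0 ≤ ∑ j ∈ Finset.Icc 1 n, Y j ω ^ 2 := Finset.sum_nonneg fun j _ => sq_nonneg _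
      positivity
  refine ⟨?_, ?_, ?_, ?_, ?_, irp, ?_⟩
  · filter_upwards [hne] with ω hω
    exact lt_of_lt_of_le (by positivity) (hlow ω)
  · simp_rw [hsub]
    exact (memLp_finsetSum _ fun j _ => (hmem j).sub (memLp_const _)).const_mul _
  · have ic : ∀ j, Integrable (fun ω => Y j ω ^ 2 - ∫ ω, Y j ω ^ 2 ∂P) P := fun j =>
      (integrable_pow_of_gaussian (hg j) 2).sub (integrable_const _)
    simp_rw [hsub]
    rw [integral_const_mul, integral_finsetSum _ fun j _ => ic j]
    refine mul_eq_zero_of_right _ (Finset.sum_eq_zero fun j _ => ?_)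
    rw [integral_sub (integrable_pow_of_gaussian (hg j) 2) (integrable_const _)]
    simp
  · simp_rw [hsub, mul_pow]
    rw [integral_const_mul]
    calc _ ≤ ((n : ℝ) * v)⁻¹ ^ 2 * (2 * (B * v ^ 2 * n)) := by gcongr
      _ = 2 * B * (n : ℝ)⁻¹ := by field_simp
      _ ≤ _ := by
        unfold concentrationConst
        gcongr
        have : 0 ≤ fourthConst * B ^ 2 := by positivity
        linarith
  · simp_rw [hsub, mul_pow]
    rw [integral_const_mul]
    calc _ ≤ ((n : ℝ) * v)⁻¹ ^ 4 * (fourthConst * (B * v ^ 2 * n) ^ 2) := by gcongr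
      _ = fourthConst * B ^ 2 * ((n : ℝ) ^ 2)⁻¹ := by field_simp
      _ ≤ _ := by
        unfold concentrationConst
        gcongr
        linarith
  · refine (integral_mono_ae irp iabs hrp).trans ?_
    rw [integral_const_mul, integral_abs_rpow_of_centred (hg 1) (h0 1), hvar 1 h1mem]
    have e : (√v) ^ (-(1 / 2) : ℝ) = (v ^ (1 / 4 : ℝ))⁻¹ := by
      rw [Real.sqrt_eq_rpow, ← Real.rpow_mul hv.le, ← Real.rpow_neg hv.le]
      norm_num
    have hv4 : 0 < v ^ (1 / 4 : ℝ) := Real.rpow_pos_of_pos hv _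
    rw [e, Real.mul_rpow hn0.le hv.le]
    calc _ = (∫ x, |x| ^ (-(1 / 2) : ℝ) ∂γ) * (n : ℝ) ^ (1 / 4 : ℝ) := by field_simp
      _ ≤ _ := by
        unfold concentrationConst
        gcongr
        have : 0 ≤ fourthConst * B ^ 2 := by positivity
        linarith

theorem integral_mean_sq_mul_mean_sq [IsProbabilityMeasure P] {Y Z : ℕ → Ω → ℝ}
    (h : ∀ j k, HasGaussianLaw (fun ω => (Y j ω, Z k ω)) P)
    (hY0 : ∀ j, ∫ ω, Y j ω ∂P = 0) (hZ0 : ∀ j, ∫ ω, Z j ω ∂P = 0) {v w : ℝ} (hv : 0 < v)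
    (hw : 0 < w) {n : ℕ} (hn : 1 ≤ n) (hvar : ∀ j ∈ Finset.Icc 1 n, ∫ ω, Y j ω ^ 2 ∂P = v)
    (hvar' : ∀ j ∈ Finset.Icc 1 n, ∫ ω, Z j ω ^ 2 ∂P = w) :
    ∫ ω, ((1 / (n : ℝ) * ∑ j ∈ Finset.Icc 1 n, Y j ω ^ 2) / v - 1) *
        ((1 / (n : ℝ) * ∑ j ∈ Finset.Icc 1 n, Z j ω ^ 2) / w - 1) ∂P =
      2 / (v * w * n ^ 2) *
        ∑ j ∈ Finset.Icc 1 n, ∑ k ∈ Finset.Icc 1 n, (∫ ω, Y j ω * Z k ω ∂P) ^ 2 := by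
  simp_rw [mean_sq_div_sub_one hn hv hvar, mean_sq_div_sub_one hn hw hvar', mul_mul_mul_comm]
  rw [integral_const_mul, integral_centred_sum_mul_centred_sum (fun j _ k _ => h j k)
    (fun j _ => hY0 j) (fun k _ => hZ0 k)]
  field_simp

end Gaussian

/-! ### Correlations of the second differences of the process. -/

variable {Ω : Type*} [MeasurableSpace Ω] {P : Measure Ω} {X : Fin 2 → ℝ → Ω → ℝ}
  {C : Fin 2 → Fin 2 → ℝ → ℝ} {p : Params}

namespace IsStationaryGaussian

theorem integral_mul (hX : IsStationaryGaussian P X C) (i j : Fin 2) (s t : ℝ) :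
    ∫ ω, X i s ω * X j t ω ∂P = C i j (t - s) := by
  simpa using hX.covariance i j s (t - s)

theorem integrable_mul (hX : IsStationaryGaussian P X C) (i j : Fin 2) (s t : ℝ) :
    Integrable (fun ω => X i s ω * X j t ω) P :=
  (hX.gaussian.hasGaussianLaw_eval (i, s)).memLp_two.integrable_mul
    (hX.gaussian.hasGaussianLaw_eval (j, t)).memLp_two

theorem isGaussianProcess_Y (hX : IsStationaryGaussian P X C) (a : Fin 2 → ℝ) (n : ℕ) :
    IsGaussianProcess (fun q : Fin 2 × ℕ × ℕ => Y (a q.1) (X q.1) n q.2.1 q.2.2) P := by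
  refine hX.gaussian.of_isGaussianProcess fun q => ?_
  set t₁ : Fin 2 × ℝ := (q.1, ((q.2.2 : ℝ) - q.2.1) / n)
  set t₂ : Fin 2 × ℝ := (q.1, (q.2.2 : ℝ) / n)
  set t₃ : Fin 2 × ℝ := (q.1, ((q.2.2 : ℝ) + q.2.1) / n)
  classical
  let I : Finset (Fin 2 × ℝ) := {t₁, t₂, t₃}
  let π : I → ((I → ℝ) →L[ℝ] ℝ) := fun t => ContinuousLinearMap.proj t
  refine ⟨I, (n : ℝ) ^ (a q.1 / 2) • (π ⟨t₁, by simp [I]⟩ - (2 : ℝ) • π ⟨t₂, by simp [I]⟩ +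
    π ⟨t₃, by simp [I]⟩), fun ω => ?_⟩
  simp [π, Y, t₁, t₂, t₃]
  ring

theorem hasGaussianLaw_Y_pair (hX : IsStationaryGaussian P X C) (a : Fin 2 → ℝ) (n : ℕ)
    (i i' : Fin 2) (u v j k : ℕ) :
    HasGaussianLaw (fun ω => (Y (a i) (X i) n u j ω, Y (a i') (X i') n v k ω)) P :=
  (hX.isGaussianProcess_Y a n).hasGaussianLaw_prodMk (s := (i, u, j)) (t := (i', v, k))

theorem isGaussianProcess_Y_right (hX : IsStationaryGaussian P X C) (a : Fin 2 → ℝ) (n : ℕ)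
    (i : Fin 2) (u : ℕ) : IsGaussianProcess (fun j : ℕ => Y (a i) (X i) n u j) P :=
  (hX.isGaussianProcess_Y a n).comp_right fun j : ℕ => (i, u, j)

theorem integral_Y (hX : IsStationaryGaussian P X C) (a : ℝ) (n : ℕ) (i : Fin 2) (u j : ℕ) :
    ∫ ω, Y a (X i) n u j ω ∂P = 0 := by
  have hi : ∀ t, Integrable (X i t) P := fun t =>
    (hX.gaussian.hasGaussianLaw_eval (i, t)).integrable
  simp only [Y]
  have i1 : Integrable (fun ω => X i (((j : ℝ) - u) / n) ω - 2 * X i ((j : ℝ) / n) ω) P :=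
    (hi _).sub ((hi _).const_mul 2)
  rw [integral_const_mul, integral_add i1 (hi _), integral_sub (hi _) ((hi _).const_mul 2),
    integral_const_mul]
  simp [hX.mean_zero]

/-- The covariance depends on the lag alone. Displacing the first time changes the lag with the
opposite sign, which a symmetric difference does not notice. -/
theorem integral_Y_mul_Y (hX : IsStationaryGaussian P X C) (a b : ℝ) {n : ℕ} (hn : 1 ≤ n)
    (i i' : Fin 2) (u v j k : ℕ) :
    ∫ ω, Y a (X i) n u j ω * Y b (X i') n v k ω ∂P = (n : ℝ) ^ ((a + b) / 2) *
      secondDiff (secondDiff (C i i') ((v : ℝ) / n)) ((u : ℝ) / n) (((k : ℝ) - j) / n) := by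
  have hn0 : (0 : ℝ) < n := by exact_mod_cast hn
  have e : ∀ ω, Y a (X i) n u j ω * Y b (X i') n v k ω = (n : ℝ) ^ ((a + b) / 2) *
      ∑ p : Fin 3, ∑ q : Fin 3, (![1, -2, 1] p * ![1, -2, 1] q) *
        (X i ((![(j : ℝ) - u, j, j + u] p) / n) ω *
          X i' ((![(k : ℝ) - v, k, k + v] q) / n) ω) := fun ω => by
    simp only [Y, Fin.sum_univ_three, Matrix.cons_val_zero, Matrix.cons_val_one, Matrix.cons_val]
    rw [add_div a b 2, Real.rpow_add hn0]
    ring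
  simp_rw [e]
  rw [integral_const_mul, integral_finsetSum _ fun p _ => integrable_finsetSum _ fun q _ =>
    (hX.integrable_mul i i' _ _).const_mul _]
  congr 1
  have e' : ∀ p : Fin 3, ∫ ω, ∑ q : Fin 3, (![1, -2, 1] p * ![1, -2, 1] q) *
        (X i ((![(j : ℝ) - u, j, j + u] p) / n) ω *
          X i' ((![(k : ℝ) - v, k, k + v] q) / n) ω) ∂P =
      ∑ q : Fin 3, (![1, -2, 1] p * ![1, -2, 1] q) *
        C i i' ((![(k : ℝ) - v, k, k + v] q) / n - (![(j : ℝ) - u, j, j + u] p) / n) := fun p => by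
    rw [integral_finsetSum _ fun q _ => (hX.integrable_mul i i' _ _).const_mul _]
    simp_rw [integral_const_mul, hX.integral_mul]
  simp_rw [e']
  simp only [Fin.sum_univ_three, Matrix.cons_val_zero, Matrix.cons_val_one, Matrix.cons_val,
    secondDiff]
  ring_nf

end IsStationaryGaussian

/-- A common rate for the decay of the correlations. -/
noncomputable def Params.rate (p : Params) (i j : Fin 2) : ℝ :=
  if i = j then p.α i else min p.α₁₂ (9 / 4)

/-- This version allows the negative exponents of the derivative bounds, at the cost of excluding
the origin; the covariance expansions use the next one, which includes it. -/
theorem isBigO_abs_rpow {a b : ℝ} (hab : a ≤ b) {l : Filter ℝ} (hl : ∀ᶠ t in l, t ≠ 0)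
    (h0 : l ≤ 𝓝 0) : (fun t : ℝ => |t| ^ b) =O[l] fun t : ℝ => |t| ^ a := by
  refine IsBigO.of_bound 1 ?_
  filter_upwards [hl, h0 (Metric.ball_mem_nhds 0 one_pos)] with t ht ht1
  rw [one_mul, Real.norm_of_nonneg (by positivity), Real.norm_of_nonneg (by positivity)]
  refine Real.rpow_le_rpow_of_exponent_ge (abs_pos.2 ht) ?_ hab
  have : |t| < 1 := by simpa using ht1
  exact this.le

theorem isBigO_abs_rpow_nhds {a b : ℝ} (ha : 0 < a) (hab : a ≤ b) :
    (fun t : ℝ => |t| ^ b) =O[𝓝 0] fun t : ℝ => |t| ^ a := by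
  refine IsBigO.of_bound 1 ?_
  filter_upwards [Metric.ball_mem_nhds (0 : ℝ) one_pos] with t ht1
  rw [one_mul, Real.norm_of_nonneg (by positivity), Real.norm_of_nonneg (by positivity)]
  refine Real.rpow_le_rpow_of_exponent_ge' (abs_nonneg t) ?_ ha.le hab
  have : |t| < 1 := by simpa using ht1
  exact this.le

theorem Params.Admissible.α₁₂_pos (hp : p.Admissible) : 0 < p.α₁₂ := by
  have h0 := hp.α_pos 0
  have h1 := hp.α_pos 1
  rcases hp.valid with h | h
  · linarith
  · linarith [h.1]

theorem Params.Admissible.rate_pos (hp : p.Admissible) (i j : Fin 2) : 0 < p.rate i j := by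
  unfold Params.rate
  split_ifs
  · exact hp.α_pos i
  · exact lt_min hp.α₁₂_pos (by norm_num)

theorem Params.Admissible.rate_le (hp : p.Admissible) (i j : Fin 2) : p.rate i j ≤ 9 / 4 := by
  unfold Params.rate
  split_ifs
  · linarith [hp.α_lt_two i]
  · exact min_le_right _ _

theorem isBigO_cov_sub (hExp : CovarianceExpansion p C) (i j : Fin 2) :
    ∃ c₀, (fun t => C i j t - c₀) =O[𝓝 0] fun t : ℝ => |t| ^ p.rate i j := by
  have hp := hExp.admissible
  have diag : ∀ i, (fun t => C i i t - p.σ i ^ 2) =O[𝓝 0] fun t : ℝ => |t| ^ p.α i := fun i => by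
    have h1 := (hExp.diag i).trans (isBigO_abs_rpow_nhds (hp.α_pos i)
      (show p.α i ≤ p.α i + p.β i by linarith [hp.β_pos i]))
    have h2 := (isBigO_refl (fun t : ℝ => |t| ^ p.α i) (𝓝 0)).const_mul_left (p.c i)
    refine (h1.sub h2).congr_left fun t => ?_
    ring
  have cross : (fun t => C 0 1 t - p.ρ * p.σ 0 * p.σ 1) =O[𝓝 0]
      fun t : ℝ => |t| ^ min p.α₁₂ (9 / 4) := by
    have hr : 0 < min p.α₁₂ (9 / 4) := lt_min hp.α₁₂_pos (by norm_num)
    have h1 := hExp.cross.trans (isBigO_abs_rpow_nhds hr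
      (show min p.α₁₂ (9 / 4) ≤ p.α₁₂ + p.β₁₂ by linarith [hp.β₁₂_pos, min_le_left p.α₁₂ (9 / 4)]))
    have h2 := (isBigO_abs_rpow_nhds hr (min_le_left _ _)).const_mul_left
      (p.ρ * p.σ 0 * p.σ 1 * p.c₁₂)
    refine (h1.sub h2).congr_left fun t => ?_
    ring
  have cross' : (fun t => C 1 0 t - p.ρ * p.σ 0 * p.σ 1) =O[𝓝 0]
      fun t : ℝ => |t| ^ min p.α₁₂ (9 / 4) := by
    refine cross.congr' ?_ EventuallyEq.rfl
    filter_upwards [hExp.cross_symm] with t ht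
    rw [ht]
  fin_cases i <;> fin_cases j
  · exact ⟨_, diag 0⟩
  · exact ⟨_, cross⟩
  · exact ⟨_, cross'⟩
  · exact ⟨_, diag 1⟩

theorem isBigO_fourth_deriv (hDer : FourthDerivativeCondition p C) (i j : Fin 2) :
    iteratedDeriv 4 (C i j) =O[𝓝[≠] 0] fun t : ℝ => |t| ^ (p.rate i j - 4) := by
  have aux : ∀ {f : ℝ → ℝ} {b a : ℝ}, (fun t : ℝ => f t - b * |t| ^ (a - 4)) =o[𝓝[≠] 0]
      (fun t : ℝ => |t| ^ (a - 4)) → f =O[𝓝[≠] 0] fun t : ℝ => |t| ^ (a - 4) := fun {f b a} h => by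
    have h2 := (isBigO_refl (fun t : ℝ => |t| ^ (a - 4)) (𝓝[≠] 0)).const_mul_left b
    refine (h.isBigO.add h2).congr_left fun t => ?_
    ring
  unfold Params.rate
  split_ifs with hij
  · subst hij
    exact aux (hDer.diag i)
  · exact (aux (hDer.cross i j hij)).trans (isBigO_abs_rpow
      (by linarith [min_le_left p.α₁₂ (9 / 4)]) eventually_mem_nhdsWithin nhdsWithin_le_nhds)

theorem exists_bound_integral_Y_mul_Y (hX : IsStationaryGaussian P X C)
    (hExp : CovarianceExpansion p C) (hDer : FourthDerivativeCondition p C) (i i' : Fin 2) (m : ℕ) :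
    ∃ K : ℝ, 0 ≤ K ∧ ∀ᶠ n : ℕ in atTop, ∀ u ∈ Finset.Icc 1 m, ∀ v ∈ Finset.Icc 1 m,
      ∀ j ∈ Finset.Icc 1 n, ∀ k ∈ Finset.Icc 1 n,
      |∫ ω, Y (p.α i) (X i) n u j ω * Y (p.α i') (X i') n v k ω ∂P| ≤
        K * (n : ℝ) ^ ((p.α i + p.α i') / 2 - p.rate i i') * decay m (Nat.dist j k) := by
  have hp := hExp.admissible
  -- The decay estimate concerns nonnegative lags. The case `k ≤ j` follows by exchanging the two
  -- components.
  have main : ∀ i i' : Fin 2, ∃ K : ℝ, 0 ≤ K ∧ ∀ᶠ n : ℕ in atTop, ∀ u ∈ Finset.Icc 1 m,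
      ∀ v ∈ Finset.Icc 1 m, ∀ j ∈ Finset.Icc 1 n, ∀ k ∈ Finset.Icc 1 n, j ≤ k →
      |∫ ω, Y (p.α i) (X i) n u j ω * Y (p.α i') (X i') n v k ω ∂P| ≤
        K * (n : ℝ) ^ ((p.α i + p.α i') / 2 - p.rate i i') * decay m (Nat.dist j k) := by
    intro i i'
    obtain ⟨c₀, hc₀⟩ := isBigO_cov_sub hExp i i'
    obtain ⟨K, hK, h⟩ := exists_bound_secondDiff_secondDiff (hp.rate_pos i i') (hp.rate_le i i') hc₀
      (hDer.differentiable i i') (isBigO_fourth_deriv hDer i i') m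
    refine ⟨K, hK, ?_⟩
    filter_upwards [h, eventually_ge_atTop 1] with n hn hn1 u hu v hv j hj k hk hjk
    have hn0 : (0 : ℝ) < n := by exact_mod_cast hn1
    have := hn u hu v hv (k - j) ((Nat.sub_le _ _).trans (Finset.mem_Icc.1 hk).2)
    rw [Nat.cast_sub hjk] at this
    rw [hX.integral_Y_mul_Y _ _ hn1, abs_mul, abs_of_pos (Real.rpow_pos_of_pos hn0 _),
      Nat.dist_eq_sub_of_le hjk,
      sub_eq_add_neg ((p.α i + p.α i') / 2), Real.rpow_add hn0]
    calc _ ≤ (n : ℝ) ^ ((p.α i + p.α i') / 2) *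
          (K * (n : ℝ) ^ (-p.rate i i') * decay m (k - j)) := by gcongr
      _ = _ := by ring
  obtain ⟨K₁, hK₁, h₁⟩ := main i i'
  obtain ⟨K₂, hK₂, h₂⟩ := main i' i
  refine ⟨max K₁ K₂, le_max_of_le_left hK₁, ?_⟩
  have hr : p.rate i' i = p.rate i i' := by
    unfold Params.rate
    rcases eq_or_ne i i' with rfl | h
    · rfl
    · rw [if_neg h, if_neg h.symm]
  filter_upwards [h₁, h₂] with n hn₁ hn₂ u hu v hv j hj k hk
  have hd := decay_nonneg m (Nat.dist j k)
  rcases le_total j k with hjk | hjk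
  · refine (hn₁ u hu v hv j hj k hk hjk).trans ?_
    gcongr
    exact le_max_left _ _
  · have := hn₂ v hv u hu k hk j hj hjk
    simp_rw [mul_comm (Y (p.α i') _ _ _ _ _)] at this
    rw [hr, add_comm (p.α i'), Nat.dist_comm] at this
    refine this.trans ?_
    gcongr
    exact le_max_right _ _

theorem exists_bound_sum_sq_integral_Y_mul_Y (hX : IsStationaryGaussian P X C)
    (hExp : CovarianceExpansion p C) (hDer : FourthDerivativeCondition p C) (i i' : Fin 2) (m : ℕ) :
    ∃ K : ℝ, 0 ≤ K ∧ ∀ᶠ n : ℕ in atTop, ∀ u ∈ Finset.Icc 1 m, ∀ v ∈ Finset.Icc 1 m,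
      ∑ j ∈ Finset.Icc 1 n, ∑ k ∈ Finset.Icc 1 n,
        (∫ ω, Y (p.α i) (X i) n u j ω * Y (p.α i') (X i') n v k ω ∂P) ^ 2 ≤
      K * ((n : ℝ) ^ ((p.α i + p.α i') / 2 - p.rate i i')) ^ 2 * n := by
  obtain ⟨K, hK, h⟩ := exists_bound_integral_Y_mul_Y hX hExp hDer i i' m
  have hs := summable_decay_sq m
  have hs0 : 0 ≤ ∑' h, decay m h ^ 2 := tsum_nonneg fun h => sq_nonneg _
  refine ⟨K ^ 2 * (2 * ∑' h, decay m h ^ 2), by positivity, ?_⟩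
  filter_upwards [h] with n hn u hu v hv
  calc _ ≤ ∑ j ∈ Finset.Icc 1 n, ∑ k ∈ Finset.Icc 1 n,
        (K * (n : ℝ) ^ ((p.α i + p.α i') / 2 - p.rate i i')) ^ 2 * decay m (Nat.dist j k) ^ 2 := by
        refine Finset.sum_le_sum fun j hj => Finset.sum_le_sum fun k hk => ?_
        rw [← sq_abs, ← mul_pow]
        exact pow_le_pow_left₀ (abs_nonneg _) (hn u hu v hv j hj k hk) 2
    _ = (K * (n : ℝ) ^ ((p.α i + p.α i') / 2 - p.rate i i')) ^ 2 *
        ∑ j ∈ Finset.Icc 1 n, ∑ k ∈ Finset.Icc 1 n, decay m (Nat.dist j k) ^ 2 := by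
        simp_rw [Finset.mul_sum]
    _ ≤ (K * (n : ℝ) ^ ((p.α i + p.α i') / 2 - p.rate i i')) ^ 2 *
        (n * (2 * ∑' h, decay m h ^ 2)) := by
        gcongr
        exact sum_dist_le (fun h => sq_nonneg (decay m h)) hs n
    _ = _ := by ring

/-! ### Expectation of the mean squares and the bias. -/

/-- The second moment of the normalised second differences. -/
noncomputable def secondMoment (p : Params) (C : Fin 2 → Fin 2 → ℝ → ℝ) (i : Fin 2) (u n : ℕ) : ℝ :=
  (n : ℝ) ^ p.α i * secondDiff (secondDiff (C i i) ((u : ℝ) / n)) ((u : ℝ) / n) 0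

theorem integral_Y_sq (hX : IsStationaryGaussian P X C) {n : ℕ} (hn : 1 ≤ n) (i : Fin 2)
    (u j : ℕ) : ∫ ω, Y (p.α i) (X i) n u j ω ^ 2 ∂P = secondMoment p C i u n := by
  simp_rw [sq]
  rw [hX.integral_Y_mul_Y _ _ hn, secondMoment]
  simp

/-- The limit of the second moment for dilation `1`. -/
noncomputable def Params.limitVar (p : Params) (i : Fin 2) : ℝ := p.c i * (8 - 2 * 2 ^ p.α i)

theorem Params.Admissible.limitVar_pos (hp : p.Admissible) (i : Fin 2) : 0 < p.limitVar i := by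
  refine mul_pos (hp.c_pos i) ?_
  have : (2 : ℝ) ^ p.α i < 2 ^ (2 : ℝ) := Real.rpow_lt_rpow_of_exponent_lt (by norm_num)
    (hp.α_lt_two i)
  norm_num at this
  linarith

theorem secondDiff_secondDiff_zero (f : ℝ → ℝ) (d : ℝ) :
    secondDiff (secondDiff f d) d 0 =
      f (-(2 * d)) - 4 * f (-d) + 6 * f 0 - 4 * f d + f (2 * d) := by
  simp only [secondDiff]
  ring_nf

theorem isBigO_secondMoment_sub (hExp : CovarianceExpansion p C) (i : Fin 2) (u : ℕ) :
    (fun n : ℕ => secondMoment p C i u n - p.limitVar i * (u : ℝ) ^ p.α i) =O[atTop]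
      fun n : ℕ => (n : ℝ) ^ (-p.β i) := by
  have hα := hExp.admissible.α_pos i
  have hβ := hExp.admissible.β_pos i
  obtain ⟨K, hK, hO⟩ := (hExp.diag i).exists_pos
  obtain ⟨δ, hδ, hbd⟩ := Metric.eventually_nhds_iff.1 hO.bound
  obtain ⟨N, hN⟩ := exists_nat_gt (2 * u / δ)
  refine IsBigO.of_bound (16 * (K * (2 * u) ^ (p.α i + p.β i))) ?_
  filter_upwards [eventually_ge_atTop N, eventually_ge_atTop 1] with n hn hn1
  have hn0 : (0 : ℝ) < n := by exact_mod_cast hn1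
  have hd : 2 * (u : ℝ) / n < δ := by
    rw [div_lt_iff₀ hn0]
    rw [div_lt_iff₀ hδ] at hN
    have : (N : ℝ) ≤ n := by exact_mod_cast hn
    nlinarith
  set r : ℝ → ℝ := fun t => C i i t - (p.σ i ^ 2 - p.c i * |t| ^ p.α i) with hr
  have h1 := abs_secondDiff_secondDiff_le_of_near (f := r) (c₀ := 0) (a := p.α i + p.β i)
    (x := u / n) (y := u / n) (t := 0) (s := 2 * u / n) (by linarith) hK.le (fun z hz => by
      have := hbd (y := z) (by simpa using hz.trans_lt hd)
      rw [Real.norm_eq_abs, Real.norm_of_nonneg (by positivity)] at this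
      simpa using this) (by positivity) (by positivity) le_rfl (le_of_eq (by ring))
  -- With coefficients 1, -4, 6, -4, 1 the constant σ² cancels and -c|t|^α contributes c (8 - 2 ·
  -- 2^α) d^α.
  have e1 : secondDiff (secondDiff (C i i) ((u : ℝ) / n)) ((u : ℝ) / n) 0 =
      secondDiff (secondDiff r ((u : ℝ) / n)) ((u : ℝ) / n) 0 +
        p.limitVar i * ((u : ℝ) / n) ^ p.α i := by
    have hd0 : 0 ≤ (u : ℝ) / n := by positivity
    generalize (u : ℝ) / n = d at hd0
    have q : |2 * d| ^ p.α i = 2 ^ p.α i * d ^ p.α i := by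
      rw [abs_of_nonneg (by positivity), Real.mul_rpow (by norm_num) hd0]
    rw [secondDiff_secondDiff_zero, secondDiff_secondDiff_zero]
    simp only [hr, abs_neg, q, abs_zero, Real.zero_rpow hα.ne', abs_of_nonneg hd0,
      Params.limitVar]
    ring
  have e2 : (n : ℝ) ^ p.α i * ((u : ℝ) / n) ^ p.α i = (u : ℝ) ^ p.α i := by
    rw [← Real.mul_rpow hn0.le (by positivity)]
    congr 1
    field_simp
  have e3 : secondMoment p C i u n - p.limitVar i * (u : ℝ) ^ p.α i =
      (n : ℝ) ^ p.α i * secondDiff (secondDiff r ((u : ℝ) / n)) ((u : ℝ) / n) 0 := by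
    rw [secondMoment, e1, ← e2]
    ring
  have e4 : (n : ℝ) ^ p.α i * (2 * u / n) ^ (p.α i + p.β i) =
      (2 * u) ^ (p.α i + p.β i) * (n : ℝ) ^ (-p.β i) := by
    have : (n : ℝ) ^ p.α i = (n : ℝ) ^ (-p.β i) * (n : ℝ) ^ (p.α i + p.β i) := by
      rw [← Real.rpow_add hn0]; ring_nf
    rw [Real.div_rpow (by positivity) hn0.le, this]
    field_simp
  rw [e3, norm_mul, Real.norm_of_nonneg (by positivity), Real.norm_eq_abs,
    Real.norm_of_nonneg (by positivity)]
  calc _ ≤ (n : ℝ) ^ p.α i * (16 * (K * (2 * u / n) ^ (p.α i + p.β i))) := by gcongr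
    _ = 16 * (K * ((n : ℝ) ^ p.α i * (2 * u / n) ^ (p.α i + p.β i))) := by ring
    _ = _ := by rw [e4]; ring

theorem tendsto_secondMoment (hExp : CovarianceExpansion p C) (i : Fin 2) (u : ℕ) :
    Tendsto (fun n : ℕ => secondMoment p C i u n) atTop (𝓝 (p.limitVar i * (u : ℝ) ^ p.α i)) := by
  have h := (isBigO_secondMoment_sub hExp i u).trans_tendsto
    ((tendsto_rpow_neg_atTop (hExp.admissible.β_pos i)).comp tendsto_natCast_atTop_atTop)
  simpa using h.add_const (p.limitVar i * (u : ℝ) ^ p.α i)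

/-- The deterministic part of the error of the estimators. -/
noncomputable def bias (p : Params) (C : Fin 2 → Fin 2 → ℝ → ℝ) (m : ℕ) (L : Fin 2 → ℕ → ℝ)
    (i : Fin 2) (n : ℕ) : ℝ :=
  ∑ u ∈ Finset.Icc 1 m, L i u * Real.log (secondMoment p C i u n) - p.α i

theorem isBigO_bias (hExp : CovarianceExpansion p C) {m : ℕ} {L : Fin 2 → ℕ → ℝ} {i : Fin 2}
    (hL : IsWeight m (L i)) :
    (fun n => bias p C m L i n) =O[atTop] fun n : ℕ => (n : ℝ) ^ (-p.β i) := by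
  have hκ := hExp.admissible.limitVar_pos i
  have hpos : ∀ u ∈ Finset.Icc 1 m, (0 : ℝ) < u := fun u hu => by
    exact_mod_cast (Finset.mem_Icc.1 hu).1
  have e : ∀ n, bias p C m L i n = ∑ u ∈ Finset.Icc 1 m, L i u *
      (Real.log (secondMoment p C i u n) - Real.log (p.limitVar i * (u : ℝ) ^ p.α i)) := fun n => by
    -- The zero sum of the weights removes the unknown scale; the normalisation against `log u`
    -- leaves α.
    have h1 : ∑ u ∈ Finset.Icc 1 m, L i u * Real.log (p.limitVar i * (u : ℝ) ^ p.α i) =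
        p.α i := by
      calc _ = ∑ u ∈ Finset.Icc 1 m, (Real.log (p.limitVar i) * L i u +
            p.α i * (L i u * Real.log u)) := by
            refine Finset.sum_congr rfl fun u hu => ?_
            rw [Real.log_mul hκ.ne' (Real.rpow_pos_of_pos (hpos u hu) _).ne',
              Real.log_rpow (hpos u hu)]
            ring
        _ = _ := by
            rw [Finset.sum_add_distrib, ← Finset.mul_sum, ← Finset.mul_sum, hL.1, hL.2]
            ring
    simp_rw [mul_sub]
    rw [Finset.sum_sub_distrib, h1, bias]
  simp_rw [e]
  refine IsBigO.fun_sum fun u hu => ?_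
  refine IsBigO.const_mul_left ?_ _
  have hlim : p.limitVar i * (u : ℝ) ^ p.α i ≠ 0 :=
    (mul_pos hκ (Real.rpow_pos_of_pos (hpos u hu) _)).ne'
  exact ((Real.hasDerivAt_log hlim).isBigO_sub.comp_tendsto (tendsto_secondMoment hExp i u)).trans
    (isBigO_secondMoment_sub hExp i u)

/-! ### Normalised mean squares. -/

/-- The mean of the squared second differences, divided by its expectation. -/
noncomputable def normZbar (p : Params) (X : Fin 2 → ℝ → Ω → ℝ) (C : Fin 2 → Fin 2 → ℝ → ℝ)
    (i : Fin 2) (u n : ℕ) (ω : Ω) : ℝ :=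
  Zbar (p.α i) (X i) n u ω / secondMoment p C i u n

theorem exists_lower_bound_secondMoment (hExp : CovarianceExpansion p C) (m : ℕ) :
    ∃ v₀ : ℝ, 0 < v₀ ∧ ∀ᶠ n : ℕ in atTop, ∀ i, ∀ u ∈ Finset.Icc 1 m,
      v₀ ≤ secondMoment p C i u n := by
  have hκ := hExp.admissible.limitVar_pos
  refine ⟨min (p.limitVar 0) (p.limitVar 1) / 2, half_pos (lt_min (hκ 0) (hκ 1)), ?_⟩
  rw [eventually_all]
  intro i
  rw [Filter.eventually_all_finset]
  intro u hu
  refine (tendsto_secondMoment hExp i u).eventually_const_le ?_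
  have h1 : (1 : ℝ) ≤ (u : ℝ) ^ p.α i :=
    Real.one_le_rpow (by exact_mod_cast (Finset.mem_Icc.1 hu).1) (hExp.admissible.α_pos i).le
  have h2 : min (p.limitVar 0) (p.limitVar 1) ≤ p.limitVar i := by
    fin_cases i
    · exact min_le_left _ _
    · exact min_le_right _ _
  have h3 := lt_min (hκ 0) (hκ 1)
  nlinarith [hκ i]

theorem exists_isConcentrated_normZbar (hX : IsStationaryGaussian P X C)
    (hExp : CovarianceExpansion p C) (hDer : FourthDerivativeCondition p C) (m : ℕ) :
    ∃ K : ℝ, ∀ᶠ n : ℕ in atTop, ∀ i, ∀ u ∈ Finset.Icc 1 m,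
      IsConcentrated P K n (normZbar p X C i u n) := by
  obtain ⟨v₀, hv₀, hv⟩ := exists_lower_bound_secondMoment hExp m
  choose K hK h using fun i => exists_bound_sum_sq_integral_Y_mul_Y hX hExp hDer i i m
  have hB : 0 ≤ (K 0 + K 1) / v₀ ^ 2 := by have := hK 0; have := hK 1; positivity
  refine ⟨concentrationConst ((K 0 + K 1) / v₀ ^ 2), ?_⟩
  filter_upwards [hv, eventually_all.2 h, eventually_ge_atTop 1] with n hn hs hn1 i u hu
  refine isConcentrated_mean_sq (hX.isGaussianProcess_Y_right p.α n i u)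
    (fun j => hX.integral_Y _ _ _ _ _) (hv₀.trans_le (hn i u hu)) hn1
    (fun j _ => integral_Y_sq hX hn1 i u j) hB ((hs i u hu u hu).trans ?_)
  have e : (p.α i + p.α i) / 2 - p.rate i i = 0 := by simp [Params.rate]
  rw [e, Real.rpow_zero, one_pow, mul_one]
  gcongr
  calc K i ≤ K 0 + K 1 := by
        fin_cases i
        · simpa using hK 1
        · simpa using hK 0
    _ = (K 0 + K 1) / v₀ ^ 2 * v₀ ^ 2 := by field_simp
    _ ≤ _ := by gcongr; exact hn i u hu

theorem isLittleO_integral_normZbar_mul (hX : IsStationaryGaussian P X C)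
    [IsProbabilityMeasure P] (hExp : CovarianceExpansion p C) (hDer : FourthDerivativeCondition p C)
    (hlt : (p.α 0 + p.α 1) / 2 < p.α₁₂) {m : ℕ} {i j : Fin 2} (hij : i ≠ j) {u v : ℕ}
    (hu : u ∈ Finset.Icc 1 m) (hv : v ∈ Finset.Icc 1 m) :
    (fun n : ℕ => ∫ ω, (normZbar p X C i u n ω - 1) * (normZbar p X C j v n ω - 1) ∂P)
      =o[atTop] fun n : ℕ => (n : ℝ)⁻¹ := by
  obtain ⟨v₀, hv₀, hvar⟩ := exists_lower_bound_secondMoment hExp m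
  obtain ⟨K, hK, h⟩ := exists_bound_sum_sq_integral_Y_mul_Y hX hExp hDer i j m
  set ε := p.rate i j - (p.α i + p.α j) / 2 with hε
  have hε0 : 0 < ε := by
    have h1 : (p.α i + p.α j) / 2 = (p.α 0 + p.α 1) / 2 := by
      fin_cases i <;> fin_cases j <;> simp_all [add_comm]
    rw [hε, Params.rate, if_neg hij, h1, sub_pos]
    -- Capping the cross rate at 9/4 is harmless, as the mean of the two indices is below 2.
    exact lt_min hlt (by linarith [hExp.admissible.α_lt_two 0, hExp.admissible.α_lt_two 1])
  have hO : (fun n : ℕ => ∫ ω, (normZbar p X C i u n ω - 1) * (normZbar p X C j v n ω - 1) ∂P)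
      =O[atTop] fun n : ℕ => (n : ℝ) ^ (-(2 * ε)) * (n : ℝ)⁻¹ := by
    refine IsBigO.of_bound (2 * K / (v₀ * v₀)) ?_
    filter_upwards [hvar, h, eventually_ge_atTop 1] with n hn hs hn1
    have hn0 : (0 : ℝ) < n := by exact_mod_cast hn1
    have hvi := hn i u hu
    have hvj := hn j v hv
    have hvi0 := hv₀.trans_le hvi
    have hvj0 := hv₀.trans_le hvj
    have e := integral_mean_sq_mul_mean_sq
      (fun k l => hX.hasGaussianLaw_Y_pair p.α n i j u v k l)
      (fun k => hX.integral_Y _ _ _ _ _) (fun k => hX.integral_Y _ _ _ _ _) hvi0 hvj0 hn1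
      (fun k _ => integral_Y_sq hX hn1 i u k) (fun k _ => integral_Y_sq hX hn1 j v k)
    change ‖∫ ω, ((1 / (n : ℝ) * ∑ k ∈ Finset.Icc 1 n, Y (p.α i) (X i) n u k ω ^ 2) /
      secondMoment p C i u n - 1) * ((1 / (n : ℝ) * ∑ k ∈ Finset.Icc 1 n,
        Y (p.α j) (X j) n v k ω ^ 2) / secondMoment p C j v n - 1) ∂P‖ ≤ _
    rw [e, Real.norm_of_nonneg (by positivity), Real.norm_of_nonneg (by positivity)]
    have e2 : ((n : ℝ) ^ ((p.α i + p.α j) / 2 - p.rate i j)) ^ 2 = (n : ℝ) ^ (-(2 * ε)) := by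
      rw [← Real.rpow_natCast, ← Real.rpow_mul hn0.le, hε]
      congr 1
      push_cast
      ring
    have hs' := hs u hu v hv
    rw [e2] at hs'
    calc _ ≤ 2 / (v₀ * v₀ * (n : ℝ) ^ 2) * (K * (n : ℝ) ^ (-(2 * ε)) * n) := by gcongr
      _ = _ := by field_simp
  refine hO.trans_isLittleO ?_
  have h1 : (fun n : ℕ => (n : ℝ) ^ (-(2 * ε))) =o[atTop] fun _ : ℕ => (1 : ℝ) :=
    (isLittleO_one_iff ℝ).2 ((tendsto_rpow_neg_atTop (by linarith)).comp
      tendsto_natCast_atTop_atTop)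
  simpa using h1.mul_isBigO (isBigO_refl (fun n : ℕ => (n : ℝ)⁻¹) atTop)

theorem eventually_Zbar_pos (hX : IsStationaryGaussian P X C)
    (hExp : CovarianceExpansion p C) (hDer : FourthDerivativeCondition p C) (m : ℕ) :
    ∀ᶠ n : ℕ in atTop, ∀ i, ∀ u ∈ Finset.Icc 1 m, 0 < secondMoment p C i u n ∧
      ∀ᵐ ω ∂P, 0 < Zbar (p.α i) (X i) n u ω := by
  obtain ⟨K, hK⟩ := exists_isConcentrated_normZbar hX hExp hDer m
  obtain ⟨v₀, hv₀, hv⟩ := exists_lower_bound_secondMoment hExp m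
  filter_upwards [hK, hv] with n hn hv i u hu
  have hpos := hv₀.trans_le (hv i u hu)
  refine ⟨hpos, ?_⟩
  filter_upwards [(hn i u hu).pos] with ω hω
  exact (div_pos_iff_of_pos_right hpos).1 hω

/-- The random part of the error of the estimators. -/
noncomputable def fluct (p : Params) (X : Fin 2 → ℝ → Ω → ℝ) (C : Fin 2 → Fin 2 → ℝ → ℝ) (m : ℕ)
    (L : Fin 2 → ℕ → ℝ) (i : Fin 2) (n : ℕ) (ω : Ω) : ℝ :=
  ∑ u ∈ Finset.Icc 1 m, L i u * Real.log (normZbar p X C i u n ω)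

theorem eventually_alphaHat_sub_ae_eq {m : ℕ} (L : Fin 2 → ℕ → ℝ)
    (hX : IsStationaryGaussian P X C) (hExp : CovarianceExpansion p C)
    (hDer : FourthDerivativeCondition p C) :
    ∀ᶠ n : ℕ in atTop, ∀ i, ∀ᵐ ω ∂P, alphaHat (p.α i) (X i) m (L i) n ω - p.α i =
      fluct p X C m L i n ω + bias p C m L i n := by
  filter_upwards [eventually_Zbar_pos hX hExp hDer m] with n hn i
  have : ∀ᵐ ω ∂P, ∀ u ∈ Finset.Icc 1 m, 0 < Zbar (p.α i) (X i) n u ω :=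
    (ae_ball_iff (Finset.countable_toSet _)).2 fun u hu => (hn i u hu).2
  filter_upwards [this] with ω hω
  rw [fluct, bias, alphaHat, ← add_sub_assoc, ← Finset.sum_add_distrib]
  congr 1
  refine Finset.sum_congr rfl fun u hu => ?_
  rw [normZbar, Real.log_div (hω u hu).ne' (hn i u hu).1.ne']
  ring

/-! ### Random part of the error and assembly. -/

section Fluctuations

variable [IsProbabilityMeasure P] {m : ℕ} (L : Fin 2 → ℕ → ℝ)

theorem eventually_integral_fluct_mul (hX : IsStationaryGaussian P X C)
    (hExp : CovarianceExpansion p C) (hDer : FourthDerivativeCondition p C) (i j : Fin 2) :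
    ∀ᶠ n : ℕ in atTop, ∫ ω, fluct p X C m L i n ω * fluct p X C m L j n ω ∂P =
      ∑ u ∈ Finset.Icc 1 m, ∑ v ∈ Finset.Icc 1 m, L i u * L j v *
        ∫ ω, Real.log (normZbar p X C i u n ω) * Real.log (normZbar p X C j v n ω) ∂P := by
  obtain ⟨K, hK⟩ := exists_isConcentrated_normZbar hX hExp hDer m
  filter_upwards [hK, eventually_ge_atTop 1] with n hn hn1
  have hn1' : (1 : ℝ) ≤ n := by exact_mod_cast hn1
  have e : ∀ ω, fluct p X C m L i n ω * fluct p X C m L j n ω =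
      ∑ u ∈ Finset.Icc 1 m, ∑ v ∈ Finset.Icc 1 m, L i u * L j v *
        (Real.log (normZbar p X C i u n ω) * Real.log (normZbar p X C j v n ω)) := fun ω => by
    simp only [fluct, Finset.sum_mul_sum]
    exact Finset.sum_congr rfl fun u _ => Finset.sum_congr rfl fun v _ => by ring
  have hint : ∀ u ∈ Finset.Icc 1 m, ∀ v ∈ Finset.Icc 1 m, Integrable (fun ω => L i u * L j v *
      (Real.log (normZbar p X C i u n ω) * Real.log (normZbar p X C j v n ω))) P :=
    fun u hu v hv =>
      (((hn i u hu).memLp_log hn1').integrable_mul ((hn j v hv).memLp_log hn1')).const_mul _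
  simp_rw [e]
  rw [integral_finsetSum _ fun u hu => integrable_finsetSum _ fun v hv => hint u hu v hv]
  refine Finset.sum_congr rfl fun u hu => ?_
  rw [integral_finsetSum _ fun v hv => hint u hu v hv]
  exact Finset.sum_congr rfl fun v hv => integral_const_mul _ _

theorem isLittleO_integral_log_mul_log_sub (hX : IsStationaryGaussian P X C)
    (hExp : CovarianceExpansion p C) (hDer : FourthDerivativeCondition p C) (i j : Fin 2) {u v : ℕ}
    (hu : u ∈ Finset.Icc 1 m) (hv : v ∈ Finset.Icc 1 m) :
    (fun n : ℕ => ∫ ω, Real.log (normZbar p X C i u n ω) * Real.log (normZbar p X C j v n ω) ∂P -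
        ∫ ω, (normZbar p X C i u n ω - 1) * (normZbar p X C j v n ω - 1) ∂P)
      =o[atTop] fun n : ℕ => (n : ℝ)⁻¹ := by
  obtain ⟨K, hK⟩ := exists_isConcentrated_normZbar hX hExp hDer m
  have hO : (fun n : ℕ =>
      ∫ ω, Real.log (normZbar p X C i u n ω) * Real.log (normZbar p X C j v n ω) ∂P -
        ∫ ω, (normZbar p X C i u n ω - 1) * (normZbar p X C j v n ω - 1) ∂P)
      =O[atTop] fun n : ℕ => (n : ℝ) ^ (-(1 / 8) : ℝ) * (n : ℝ)⁻¹ := by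
    refine IsBigO.of_bound ((2 * (2 * 32 ^ 8 + 82) + 1) * K) ?_
    filter_upwards [hK, eventually_ge_atTop 1] with n hn hn1
    have hn0 : (0 : ℝ) < n := by exact_mod_cast hn1
    have := (hn i u hu).abs_integral_log_mul_log_sub_le (hn j v hv) (by exact_mod_cast hn1)
    rw [Real.norm_eq_abs, Real.norm_of_nonneg (by positivity)]
    refine this.trans_eq ?_
    rw [← Real.rpow_neg_one, ← Real.rpow_add hn0]
    norm_num
  refine hO.trans_isLittleO ?_
  have h1 : (fun n : ℕ => (n : ℝ) ^ (-(1 / 8) : ℝ)) =o[atTop] fun _ : ℕ => (1 : ℝ) :=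
    (isLittleO_one_iff ℝ).2 ((tendsto_rpow_neg_atTop (by norm_num)).comp
      tendsto_natCast_atTop_atTop)
  simpa using h1.mul_isBigO (isBigO_refl (fun n : ℕ => (n : ℝ)⁻¹) atTop)

/-- The off-diagonal entries are dominated by the two variances, so no decay of the
cross-correlations enters. -/
theorem isBigO_integral_fluct_mul (hX : IsStationaryGaussian P X C)
    (hExp : CovarianceExpansion p C) (hDer : FourthDerivativeCondition p C) (i j : Fin 2) :
    (fun n : ℕ => ∫ ω, fluct p X C m L i n ω * fluct p X C m L j n ω ∂P) =O[atTop]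
      fun n : ℕ => (n : ℝ)⁻¹ := by
  obtain ⟨K, hK⟩ := exists_isConcentrated_normZbar hX hExp hDer m
  refine IsBigO.congr' ?_ (EventuallyEq.symm (eventually_integral_fluct_mul L hX hExp hDer i j))
    EventuallyEq.rfl
  refine IsBigO.fun_sum fun u hu => ?_
  refine IsBigO.fun_sum fun v hv => ?_
  refine IsBigO.const_mul_left ?_ _
  have h1 : (fun n : ℕ => ∫ ω, (normZbar p X C i u n ω - 1) * (normZbar p X C j v n ω - 1) ∂P)
      =O[atTop] fun n : ℕ => (n : ℝ)⁻¹ := by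
    refine IsBigO.of_bound K ?_
    filter_upwards [hK] with n hn
    rw [Real.norm_eq_abs, Real.norm_of_nonneg (by positivity)]
    exact (hn i u hu).abs_integral_mul_le (hn j v hv)
  simpa using (isLittleO_integral_log_mul_log_sub hX hExp hDer i j hu hv).isBigO.add h1

theorem isLittleO_integral_fluct_mul (hX : IsStationaryGaussian P X C)
    (hExp : CovarianceExpansion p C) (hDer : FourthDerivativeCondition p C)
    (hlt : (p.α 0 + p.α 1) / 2 < p.α₁₂) {i j : Fin 2} (hij : i ≠ j) :
    (fun n : ℕ => ∫ ω, fluct p X C m L i n ω * fluct p X C m L j n ω ∂P) =o[atTop]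
      fun n : ℕ => (n : ℝ)⁻¹ := by
  refine IsLittleO.congr' ?_ (EventuallyEq.symm (eventually_integral_fluct_mul L hX hExp hDer i j))
    EventuallyEq.rfl
  refine IsLittleO.fun_sum fun u hu => ?_
  refine IsLittleO.fun_sum fun v hv => ?_
  refine IsLittleO.const_mul_left ?_ _
  simpa using (isLittleO_integral_log_mul_log_sub hX hExp hDer i j hu hv).add
    (isLittleO_integral_normZbar_mul hX hExp hDer hlt hij hu hv)

theorem isBigO_integral_fluct (hX : IsStationaryGaussian P X C)
    (hExp : CovarianceExpansion p C) (hDer : FourthDerivativeCondition p C) (i : Fin 2) :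
    (fun n : ℕ => ∫ ω, fluct p X C m L i n ω ∂P) =O[atTop] fun n : ℕ => (n : ℝ)⁻¹ := by
  obtain ⟨K, hK⟩ := exists_isConcentrated_normZbar hX hExp hDer m
  have e : (fun n : ℕ => ∑ u ∈ Finset.Icc 1 m,
      L i u * ∫ ω, Real.log (normZbar p X C i u n ω) ∂P) =ᶠ[atTop]
      fun n : ℕ => ∫ ω, fluct p X C m L i n ω ∂P := by
    filter_upwards [hK, eventually_ge_atTop 1] with n hn hn1
    have hn1' : (1 : ℝ) ≤ n := by exact_mod_cast hn1
    simp only [fluct]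
    rw [integral_finsetSum _ fun u hu =>
      (((hn i u hu).memLp_log hn1').integrable (by norm_num)).const_mul _]
    exact Finset.sum_congr rfl fun u hu => (integral_const_mul _ _).symm
  refine IsBigO.congr' ?_ e EventuallyEq.rfl
  refine IsBigO.fun_sum fun u hu => ?_
  refine IsBigO.const_mul_left (IsBigO.of_bound ((2 * 32 ^ 8 + 82) * K) ?_) _
  filter_upwards [hK, eventually_ge_atTop 1] with n hn hn1
  rw [Real.norm_eq_abs, Real.norm_of_nonneg (by positivity)]
  exact (hn i u hu).abs_integral_log_le (by exact_mod_cast hn1)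

theorem eventually_memLp_fluct (hX : IsStationaryGaussian P X C)
    (hExp : CovarianceExpansion p C) (hDer : FourthDerivativeCondition p C) :
    ∀ᶠ n : ℕ in atTop, ∀ i, MemLp (fluct p X C m L i n) 2 P := by
  obtain ⟨K, hK⟩ := exists_isConcentrated_normZbar hX hExp hDer m
  filter_upwards [hK, eventually_ge_atTop 1] with n hn hn1 i
  exact memLp_finsetSum _ fun u hu => ((hn i u hu).memLp_log (by exact_mod_cast hn1)).const_mul _

theorem eventually_errorProduct (hX : IsStationaryGaussian P X C)
    (hExp : CovarianceExpansion p C) (hDer : FourthDerivativeCondition p C) :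
    ∀ᶠ n : ℕ in atTop, ∀ i j, Integrable (errorProduct p X m L n i j) P ∧
      mseMatrix P p X m L n i j = ∫ ω, fluct p X C m L i n ω * fluct p X C m L j n ω ∂P +
        (bias p C m L j n * ∫ ω, fluct p X C m L i n ω ∂P +
          bias p C m L i n * ∫ ω, fluct p X C m L j n ω ∂P +
          bias p C m L i n * bias p C m L j n) := by
  filter_upwards [eventually_alphaHat_sub_ae_eq L hX hExp hDer,
    eventually_memLp_fluct (m := m) L hX hExp hDer] with n hn hmem i j
  have i1 : Integrable (fun ω => fluct p X C m L i n ω * fluct p X C m L j n ω) P :=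
    (hmem i).integrable_mul (hmem j)
  have iF : ∀ i, Integrable (fun ω => fluct p X C m L i n ω) P := fun i =>
    (hmem i).integrable (by norm_num)
  have i2 := (iF i).const_mul (bias p C m L j n)
  have i3 := (iF j).const_mul (bias p C m L i n)
  have i4 : Integrable (fun _ : Ω => bias p C m L i n * bias p C m L j n) P := integrable_const _
  have i23 : Integrable (fun ω => bias p C m L j n * fluct p X C m L i n ω +
      bias p C m L i n * fluct p X C m L j n ω) P := i2.add i3
  have i234 : Integrable (fun ω => bias p C m L j n * fluct p X C m L i n ω +
      bias p C m L i n * fluct p X C m L j n ω + bias p C m L i n * bias p C m L j n) P :=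
    i23.add i4
  have hae : (fun ω => fluct p X C m L i n ω * fluct p X C m L j n ω +
      (bias p C m L j n * fluct p X C m L i n ω + bias p C m L i n * fluct p X C m L j n ω +
        bias p C m L i n * bias p C m L j n)) =ᵐ[P] errorProduct p X m L n i j := by
    filter_upwards [hn i, hn j] with ω hi hj
    rw [errorProduct, hi, hj]
    ring
  refine ⟨(i1.add i234).congr hae, ?_⟩
  rw [mseMatrix, Matrix.of_apply, ← integral_congr_ae hae, integral_add i1 i234,
    integral_add i23 i4, integral_add i2 i3, integral_const_mul, integral_const_mul]
  simp

theorem isBigO_mseMatrix_sub (hX : IsStationaryGaussian P X C)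
    (hExp : CovarianceExpansion p C) (hDer : FourthDerivativeCondition p C)
    (hL : ∀ i, IsWeight m (L i)) (i j : Fin 2) :
    (fun n => mseMatrix P p X m L n i j -
        ∫ ω, fluct p X C m L i n ω * fluct p X C m L j n ω ∂P) =O[atTop]
      fun n : ℕ => (n : ℝ) ^ (-psi (p.β i) (p.β j)) := by
  have hmono : ∀ x y : ℝ, psi (p.β i) (p.β j) ≤ x + y →
      (fun n : ℕ => (n : ℝ) ^ (-x) * (n : ℝ) ^ (-y)) =O[atTop]
        fun n : ℕ => (n : ℝ) ^ (-psi (p.β i) (p.β j)) := fun x y hxy => by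
    refine IsBigO.of_bound 1 ?_
    filter_upwards [eventually_ge_atTop 1] with n hn
    have hn1 : (1 : ℝ) ≤ n := by exact_mod_cast hn
    rw [← Real.rpow_add (by linarith), one_mul, Real.norm_of_nonneg (by positivity),
      Real.norm_of_nonneg (by positivity)]
    exact Real.rpow_le_rpow_of_exponent_le hn1 (by linarith)
  have e : (fun n : ℕ => bias p C m L j n * ∫ ω, fluct p X C m L i n ω ∂P +
      bias p C m L i n * ∫ ω, fluct p X C m L j n ω ∂P +
      bias p C m L i n * bias p C m L j n) =ᶠ[atTop] fun n => mseMatrix P p X m L n i j -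
        ∫ ω, fluct p X C m L i n ω * fluct p X C m L j n ω ∂P := by
    filter_upwards [eventually_errorProduct L hX hExp hDer] with n hn
    rw [(hn i j).2]
    ring
  have hb := fun i => isBigO_bias hExp (hL i)
  have hf : ∀ i, (fun n : ℕ => ∫ ω, fluct p X C m L i n ω ∂P) =O[atTop]
      fun n : ℕ => (n : ℝ) ^ (-1 : ℝ) := fun i => by
    simpa only [Real.rpow_neg_one] using isBigO_integral_fluct L hX hExp hDer i
  refine IsBigO.congr' ?_ e EventuallyEq.rfl
  refine ((((hb j).mul (hf i)).trans (hmono _ _ ?_)).add (((hb i).mul (hf j)).trans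
    (hmono _ _ ?_))).add (((hb i).mul (hb j)).trans (hmono _ _ ?_))
  · rw [add_comm]
    exact (min_le_right _ _).trans (min_le_left _ _)
  · rw [add_comm]
    exact min_le_left _ _
  · exact (min_le_right _ _).trans (min_le_right _ _)

end Fluctuations

/-- The second moments of the random parts of the errors. -/
noncomputable def fluctMatrix {Ω : Type*} [MeasurableSpace Ω] (P : Measure Ω) (p : Params)
    (X : Fin 2 → ℝ → Ω → ℝ) (C : Fin 2 → Fin 2 → ℝ → ℝ) (m : ℕ) (L : Fin 2 → ℕ → ℝ) (n : ℕ) :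
    Matrix (Fin 2) (Fin 2) ℝ :=
  Matrix.of fun i j => ∫ ω, fluct p X C m L i n ω * fluct p X C m L j n ω ∂P

end FractalIndex

theorem theorem4 {Ω : Type*} [MeasurableSpace Ω] (P : Measure Ω) [IsProbabilityMeasure P]
    (X : Fin 2 → ℝ → Ω → ℝ) (C : Fin 2 → Fin 2 → ℝ → ℝ) (p : FractalIndex.Params)
    (hX : FractalIndex.IsStationaryGaussian P X C)
    (hExp : FractalIndex.CovarianceExpansion p C)
    (hDer : FractalIndex.FourthDerivativeCondition p C)
    (m : ℕ) (hm : 2 ≤ m) (L : Fin 2 → ℕ → ℝ) (hL : ∀ i, FractalIndex.IsWeight m (L i)) :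
    -- the estimators are almost surely defined, and the mean square errors exist, for large `n`
    (∀ᶠ n : ℕ in atTop,
      (∀ i, ∀ u ∈ Finset.Icc 1 m, ∀ᵐ ω ∂P, 0 < FractalIndex.Zbar (p.α i) (X i) n u ω) ∧
      ∀ i j, Integrable (FractalIndex.errorProduct p X m L n i j) P) ∧
    ((p.α 0 + p.α 1) / 2 = p.α₁₂ →
      ∃ A B : ℕ → Matrix (Fin 2) (Fin 2) ℝ,
        (∀ n, FractalIndex.mseMatrix P p X m L n = A n + B n) ∧
        (∀ i j, (fun n => A n i j) =O[atTop] fun n : ℕ => (n : ℝ)⁻¹) ∧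
        (∀ i j, (fun n => B n i j) =O[atTop]
          fun n : ℕ => (n : ℝ) ^ (-FractalIndex.psi (p.β i) (p.β j)))) ∧
    ((p.α 0 + p.α 1) / 2 < p.α₁₂ →
      ∃ A B : ℕ → Matrix (Fin 2) (Fin 2) ℝ,
        (∀ n, FractalIndex.mseMatrix P p X m L n = A n + B n) ∧
        (∀ i, (fun n => A n i i) =O[atTop] fun n : ℕ => (n : ℝ)⁻¹) ∧
        (∀ i j, i ≠ j → (fun n => A n i j) =o[atTop] fun n : ℕ => (n : ℝ)⁻¹) ∧
        (∀ i j, (fun n => B n i j) =O[atTop]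
          fun n : ℕ => (n : ℝ) ^ (-FractalIndex.psi (p.β i) (p.β j)))) := by
  have hpsi := FractalIndex.isBigO_mseMatrix_sub (m := m) L hX hExp hDer hL
  refine ⟨?_, fun _ => ?_, fun hlt => ?_⟩
  · filter_upwards [FractalIndex.eventually_Zbar_pos hX hExp hDer m,
      FractalIndex.eventually_errorProduct (m := m) L hX hExp hDer] with n h₁ h₂
    exact ⟨fun i u hu => (h₁ i u hu).2, fun i j => (h₂ i j).1⟩
  -- Taking the second matrix as the remainder makes the decomposition exact for every `n`,
  -- including the small ones for which integrability is not established.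
  · exact ⟨fun n => FractalIndex.fluctMatrix P p X C m L n,
      fun n => FractalIndex.mseMatrix P p X m L n - FractalIndex.fluctMatrix P p X C m L n,
      fun n => (add_sub_cancel _ _).symm,
      fun i j => FractalIndex.isBigO_integral_fluct_mul L hX hExp hDer i j, hpsi⟩
  · exact ⟨fun n => FractalIndex.fluctMatrix P p X C m L n,
      fun n => FractalIndex.mseMatrix P p X m L n - FractalIndex.fluctMatrix P p X C m L n,
      fun n => (add_sub_cancel _ _).symm,
      fun i => FractalIndex.isBigO_integral_fluct_mul L hX hExp hDer i i,
      fun i j hij => FractalIndex.isLittleO_integral_fluct_mul L hX hExp hDer hlt hij, hpsi⟩
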